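/- There is an absolute constant $C>0$ such that the following holds. Let $a$ be a symmetric, unit-variance, sub-gaussian real random variable, with sub-gaussian norm $$\kappa:=\sup_{p\ge 1}p^{-1/2}\,(\mathbb E|a|^p)^{1/p}<\infty .$$ Let $m\ge 1$ and let $a_1,\dots,a_m$ be independent random vectors in $\mathbb R^n$ whose coordinates are i.i.d. copies of $a$. Let $K\subseteq\mathbb R^n$ be contained in the closed Euclidean unit ball, and fix $x\in K$ with $\|x\|_2=1$. Let $\theta:\mathbb R\to[-1,1]$ be a $C^3$ function with $|\theta''|\le\tau_2$ and $|\theta'''|\le\tau_3$ on $\mathbb R$, and suppose that $\lambda:=\mathbb E[\theta(g)g]>0$ for $g\sim N(0,1)$. Let $y_1,\dots,y_m$ be random variables with values in $\{-1,1\}$ that are conditionally independent given $(a_1,\dots,a_m)$ and satisfy $$\mathbb E(y_i\mid a_1,\dots,a_m)=\theta(\langle a_i,x\rangle)\quad\text{almost surely},\qquad i=1,\dots,m .$$ Then for each $\beta>0$, with probability at least $1-4e^{-\beta^2}$, every solution $\hat x$ of the optimization problem $$\max\ \sum_{i=1}^m y_i\langle a_i,x'\rangle\quad\text{subject to}\quad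 x'\in K$$ satisfies $$\|x-\hat x\|_2^2\le C\left(\frac{\kappa^4}{\lambda}(\tau_2+\tau_3)\|x\|_\infty+\frac{\kappa}{\lambda\sqrt m}\,(w(K)+\beta)\right),$$ where $\|x\|_\infty=\max_j|x_j|$ and $w(K)=\mathbb E\sup_{z\in K-K}\langle g,z\rangle$, with $g$ a standard Gaussian vector in $\mathbb R^n$, is the Gaussian mean width of $K$. -/

import Mathlib

open MeasureTheory ProbabilityTheory
open scoped ENNReal Pointwise

noncomputable section

/-- The sub-gaussian norm `sup_{p ≥ 1} p^{-1/2} (E |a|^p)^{1/p}` of a real random variable,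
as an extended nonnegative real; `a` is sub-gaussian when it is finite. -/
def subGaussianNorm {Ω : Type*} [MeasurableSpace Ω] (a : Ω → ℝ) (P : Measure Ω) : ℝ≥0∞ :=
  ⨆ (p : ℝ) (_ : 1 ≤ p),
    ENNReal.ofReal (p ^ (-(1 / 2) : ℝ)) * eLpNorm a (ENNReal.ofReal p) P

/-- The Gaussian mean width `w(K) = E sup_{z ∈ K - K} ⟨g, z⟩`, with `g` a standard Gaussian
vector. For a nonempty bounded set `K` the supremum is finite and integrable in `g`. -/
def gaussianMeanWidth {n : ℕ} (K : Set (EuclideanSpace ℝ (Fin n))) : ℝ :=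
  ∫ g, sSup ((fun z => inner ℝ g z) '' (K - K)) ∂(stdGaussian (EuclideanSpace ℝ (Fin n)))

/-- The largest absolute value of a coordinate. -/
def coordSupNorm {n : ℕ} (x : EuclideanSpace ℝ (Fin n)) : ℝ := ⨆ j, |x j|

/-- The σ-algebra generated by the random vectors `A 1, …, A m`. -/
abbrev sigmaGenerated {Ω : Type*} {m n : ℕ} (A : Fin m → Ω → EuclideanSpace ℝ (Fin n)) :
    MeasurableSpace Ω :=
  MeasurableSpace.comap (fun ω i => A i ω) inferInstance

/-- The real random variables `y i` are conditionally independent given the σ-algebra `m'`: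
for all finite families of Borel sets, the conditional probability of the joint event is
almost surely the product of the conditional probabilities. (On a standard Borel space this is
Mathlib's `iCondIndepFun`.) -/
def CondIndepGiven {Ω ι : Type*} (m' : MeasurableSpace Ω) [mΩ : MeasurableSpace Ω]
    (y : ι → Ω → ℝ) (P : Measure Ω) : Prop :=
  ∀ (s : Finset ι) (B : ι → Set ℝ), (∀ i ∈ s, MeasurableSet (B i)) →
    P⟦⋂ i ∈ s, y i ⁻¹' B i | m'⟧ =ᵐ[P] ∏ i ∈ s, P⟦y i ⁻¹' B i | m'⟧

/-- The generalized linear model: `y i` takes values in `{-1, 1}`, and conditionally on the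
measurement vectors `A 1, …, A m` the `y i` are independent, with conditional expectation
`θ(⟨A i, x⟩)`. -/
structure GeneralizedLinearModel {Ω : Type*} [MeasurableSpace Ω] (P : Measure Ω) {m n : ℕ}
    (A : Fin m → Ω → EuclideanSpace ℝ (Fin n)) (y : Fin m → Ω → ℝ)
    (x : EuclideanSpace ℝ (Fin n)) (θ : ℝ → ℝ) : Prop where
  measurable : ∀ i, Measurable (y i)
  sign_valued : ∀ i ω, y i ω = 1 ∨ y i ω = -1
  condExp_eq : ∀ i, P[y i | sigmaGenerated A] =ᵐ[P] fun ω => θ (inner ℝ (A i ω) x)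
  condIndep : CondIndepGiven (sigmaGenerated A) y P

/-- `xhat` is a solution of: maximize `∑ i, y i * ⟨a i, x'⟩` over `x' ∈ K`. -/
def IsSolution {m n : ℕ} (a : Fin m → EuclideanSpace ℝ (Fin n)) (y : Fin m → ℝ)
    (K : Set (EuclideanSpace ℝ (Fin n))) (xhat : EuclideanSpace ℝ (Fin n)) : Prop :=
  xhat ∈ K ∧ IsMaxOn (fun x' => ∑ i, y i * inner ℝ (a i) x') K xhat

end

/-! ### Stein's equation for the standard Gaussian. -/

section Stein

open Filter Topology Set Real

/-! Put `z = x - xhat`. Optimality gives `∑ y_i ⟨a_i, z⟩ ≤ 0`, so `∑ E y_i ⟨a_i, z⟩` is at most the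
centred sum `∑ (y_i a_i - E y_i a_i)` tested against `-z ∈ K - K`. As `‖x‖ = 1` and `‖xhat‖ ≤ 1`,
also `⟨x, z⟩ ≥ ‖z‖² / 2`. It remains to show that each expectation is close to `λ ⟨x, z⟩`, and to
bound the centred sum uniformly over `K - K`.

Expectation (`HasStandardCoords.abs_integral_sub_gaussian_le`). Expanding in one coordinate of `a`
at a time, independently of the others, gives `E θ(⟨a, x⟩) ⟨a, z⟩ ≈ ⟨x, z⟩ E θ'(⟨a, x⟩)`, with an
error of order `∑ |z_j| x_j² ≤ ‖x‖_∞ ‖z‖`. The same expansion, applied to the solution `f` of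
Stein's equation `f'(w) - w f(w) = θ'(w) - E θ'(g)` (`exists_stein_solution`), compares `E θ'(⟨a,
x⟩)` with `E θ'(g)`, which is `λ` by Gaussian integration by parts.

Fluctuation. Comparing tails, a symmetric sub-gaussian variable is dominated in the convex order by
a multiple of `κ g` (`convexDominated_gaussianReal`). Independent sums preserve the domination, and
symmetrization costs a factor 2, so the centred sum is dominated by a Gaussian vector of size `√m
κ`. Exponentials of the support function of `K - K` are convex, hence their moments are at most the
Gaussian ones. These are bounded through a rotation argument (`integral_exp_supportFunction_le`),
and Markov's inequality gives the tail. -/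

lemma hasDerivAt_exp_neg_sq_half (w : ℝ) :
    HasDerivAt (fun w : ℝ => exp (-w ^ 2 / 2)) (-w * exp (-w ^ 2 / 2)) w := by
  have h : HasDerivAt (fun w : ℝ => -w ^ 2 / 2) (-w) w := by
    have := ((hasDerivAt_pow 2 w).neg).div_const 2
    exact this.congr_deriv (by simp; ring)
  exact h.exp.congr_deriv (by ring)

lemma tendsto_exp_neg_sq_half : Tendsto (fun w : ℝ => exp (-w ^ 2 / 2)) atTop (𝓝 0) := by
  refine tendsto_exp_atBot.comp ?_
  have : Tendsto (fun w : ℝ => w ^ 2 / 2) atTop atTop :=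
    (tendsto_pow_atTop two_ne_zero).atTop_div_const two_pos
  refine (tendsto_neg_atTop_atBot.comp this).congr fun w => ?_
  simp; ring

lemma tendsto_mul_exp_neg_sq_half :
    Tendsto (fun w : ℝ => w * exp (-w ^ 2 / 2)) atTop (𝓝 0) := by
  have h1 : Tendsto (fun w : ℝ => w * exp (-(1 / 2) * w)) atTop (𝓝 0) := by
    have := tendsto_rpow_mul_exp_neg_mul_atTop_nhds_zero 1 (1 / 2) (by norm_num)
    simpa using this
  refine squeeze_zero' ?_ ?_ h1
  · filter_upwards [eventually_ge_atTop 0] with w hw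
    positivity
  · filter_upwards [eventually_ge_atTop 1] with w hw
    gcongr
    nlinarith

/-- A function vanishing at infinity whose derivative is at most `(α w + γ) e^{-w²/2}`. -/
lemma le_mul_exp_of_deriv_ge {G q : ℝ → ℝ} {α γ : ℝ} (hγ : 0 ≤ γ)
    (hG : ∀ w, HasDerivAt G (q w * exp (-w ^ 2 / 2)) w)
    (hq : ∀ w, 0 ≤ w → -(α * w + γ) ≤ q w) (h0 : Tendsto G atTop (𝓝 0))
    {w : ℝ} (hw : 0 ≤ w) : G w ≤ (α + 2 * γ / (1 + w)) * exp (-w ^ 2 / 2) := by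
  -- The barrier minus `G` is decreasing with limit 0, hence nonnegative.
  set H : ℝ → ℝ := fun w => (α + 2 * γ * (1 + w)⁻¹) * exp (-w ^ 2 / 2) - G w with hH
  have hd : ∀ v, 0 ≤ v → HasDerivAt H ((2 * γ * (-(1 + v)⁻¹ ^ 2)) * exp (-v ^ 2 / 2) +
      (α + 2 * γ * (1 + v)⁻¹) * (-v * exp (-v ^ 2 / 2)) - q v * exp (-v ^ 2 / 2)) v := by
    intro v hv
    have h1 : HasDerivAt (fun w : ℝ => (1 + w)⁻¹) (-(1 + v)⁻¹ ^ 2) v := by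
      have := ((hasDerivAt_id v).const_add 1).inv (by simp; positivity)
      exact this.congr_deriv (by simp [neg_div])
    exact (((h1.const_mul (2 * γ)).const_add α).mul (hasDerivAt_exp_neg_sq_half v)).sub (hG v)
  have hanti : AntitoneOn H (Ici 0) := by
    refine antitoneOn_of_hasDerivWithinAt_nonpos (convex_Ici 0)
      (fun v hv => (hd v hv).continuousAt.continuousWithinAt)
      (fun v hv => (hd v (interior_subset hv)).hasDerivWithinAt) ?_
    intro v hv
    have hv : 0 ≤ v := interior_subset hv
    have h2 := hq v hv
    -- This is why the barrier carries `2 γ / (1 + w)`: the factor 2 suffices for the decay to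
    -- compensate `γ` at every `v ≥ 0`.
    have h3 : 1 ≤ 2 * (1 + v)⁻¹ ^ 2 + 2 * (1 + v)⁻¹ * v := by
      have : 0 < 1 + v := by positivity
      rw [← sub_nonneg]
      have e : 2 * (1 + v)⁻¹ ^ 2 + 2 * (1 + v)⁻¹ * v - 1 = (1 + v ^ 2) / (1 + v) ^ 2 := by
        field_simp; ring
      rw [e]; positivity
    have h4 := mul_le_mul_of_nonneg_left h3 hγ
    have h5 : 0 < exp (-v ^ 2 / 2) := exp_pos _
    have : (2 * γ * (-(1 + v)⁻¹ ^ 2)) + (α + 2 * γ * (1 + v)⁻¹) * (-v) - q v ≤ 0 := by nlinarith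
    calc _ = ((2 * γ * (-(1 + v)⁻¹ ^ 2)) + (α + 2 * γ * (1 + v)⁻¹) * (-v) - q v)
          * exp (-v ^ 2 / 2) := by ring
      _ ≤ 0 := mul_nonpos_of_nonpos_of_nonneg this h5.le
  have hlim : Tendsto H atTop (𝓝 0) := by
    have h1 : Tendsto (fun w : ℝ => (1 + w)⁻¹) atTop (𝓝 0) :=
      tendsto_inv_atTop_zero.comp (tendsto_atTop_add_const_left _ _ tendsto_id)
    have := (((h1.const_mul (2 * γ)).const_add α).mul tendsto_exp_neg_sq_half).sub h0
    simpa using this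
  have : 0 ≤ H w := by
    refine le_of_tendsto hlim ?_
    filter_upwards [eventually_ge_atTop w] with v hv
    exact hanti hw (hw.trans hv) hv
  simp only [hH, ← div_eq_mul_inv] at this
  linarith

/-- Reflecting the line reduces to `w ≥ 0`, and the one-sided barrier is applied to `G` and `-G`. -/
lemma abs_le_mul_exp_of_deriv {G q : ℝ → ℝ} {α γ : ℝ} (hγ : 0 ≤ γ)
    (hG : ∀ w, HasDerivAt G (q w * exp (-w ^ 2 / 2)) w)
    (hq : ∀ w, |q w| ≤ α * |w| + γ) (h0 : Tendsto G atTop (𝓝 0)) (h1 : Tendsto G atBot (𝓝 0))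
    (w : ℝ) : |G w| ≤ (α + 2 * γ / (1 + |w|)) * exp (-w ^ 2 / 2) := by
  wlog hw : 0 ≤ w generalizing G q w
  · have := this (G := fun w => G (-w)) (q := fun w => -q (-w)) (fun v => ?_) (fun v => ?_)
      (h1.comp tendsto_neg_atTop_atBot) (h0.comp tendsto_neg_atBot_atTop) (-w) (by linarith)
    · simpa using this
    · have := (hG (-v)).scomp v (hasDerivAt_neg v)
      exact this.congr_deriv (by simp)
    · simpa using hq (-v)
  rw [abs_of_nonneg hw, abs_le]
  constructor
  · have := le_mul_exp_of_deriv_ge (G := fun w => -G w) (q := fun w => -q w) hγ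
      (fun v => (hG v).neg.congr_deriv (by ring))
      (fun v hv => by have := (abs_le.1 (hq v)).2; rw [abs_of_nonneg hv] at this; linarith)
      (by simpa using h0.neg) hw
    linarith
  · exact le_mul_exp_of_deriv_ge hγ hG
      (fun v hv => by have := (abs_le.1 (hq v)).1; rw [abs_of_nonneg hv] at this; linarith) h0 hw

lemma integral_gaussianReal_zero_one (f : ℝ → ℝ) :
    ∫ t, f t ∂(gaussianReal 0 1) = (√(2 * π))⁻¹ * ∫ t, f t * exp (-t ^ 2 / 2) := by
  rw [integral_gaussianReal_eq_integral_smul one_ne_zero, ← integral_const_mul]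
  congr 1 with t
  simp [gaussianPDFReal]
  ring

lemma integrable_gaussianReal_zero_one_iff (f : ℝ → ℝ) :
    Integrable f (gaussianReal 0 1) ↔ Integrable (fun t => f t * exp (-t ^ 2 / 2)) := by
  rw [gaussianReal_of_var_ne_zero _ one_ne_zero, integrable_withDensity_iff_integrable_smul']
  · have : ∀ t, (gaussianPDF 0 1 t).toReal • f t
        = (√(2 * π))⁻¹ * (f t * exp (-t ^ 2 / 2)) := fun t => by
      simp [gaussianPDFReal]; ring
    simp_rw [this]
    exact integrable_const_mul_iff (IsUnit.mk0 _ (by positivity)) _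
  · exact measurable_gaussianPDF 0 1
  · simp [gaussianPDF]

lemma integral_abs_gaussianReal_le : ∫ t, |t| ∂(gaussianReal 0 1) ≤ 1 := by
  have h2 : MemLp (fun t : ℝ => t) 2 (gaussianReal 0 1) := IsGaussian.memLp_two_id
  have hv : ∫ t, t ^ 2 ∂(gaussianReal 0 1) = 1 := by
    have := variance_id_gaussianReal (μ := 0) (v := 1)
    rw [variance_eq_integral (by fun_prop)] at this
    simpa using this
  have h1 : Integrable (fun t : ℝ => |t|) (gaussianReal 0 1) := (h2.integrable one_le_two).abs
  have h3 : ∫ t, |t| ∂(gaussianReal 0 1) ≤ ∫ t, (t ^ 2 + 1) / 2 ∂(gaussianReal 0 1) := by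
    refine integral_mono h1 ((h2.integrable_sq.add (integrable_const 1)).div_const 2) fun t => ?_
    have := sq_nonneg (|t| - 1)
    simp only
    nlinarith [sq_abs t]
  rw [integral_div, integral_add h2.integrable_sq (integrable_const 1), hv] at h3
  simpa using h3

/-- Solution of Stein's equation for a function with bounded derivative. -/
theorem exists_stein_solution {h h' : ℝ → ℝ} {L : ℝ} (hd : ∀ w, HasDerivAt h (h' w) w)
    (hL : ∀ w, |h' w| ≤ L) :
    Integrable h (gaussianReal 0 1) ∧ ∃ f f' : ℝ → ℝ, (∀ w, HasDerivAt f (f' w) w) ∧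
      (∀ w, f' w - w * f w = h w - ∫ t, h t ∂(gaussianReal 0 1)) ∧
      (∀ w, |f w| ≤ 3 * L) ∧ ∀ v w, |f' v - f' w| ≤ 12 * L * |v - w| := by
  have hL0 : 0 ≤ L := (abs_nonneg _).trans (hL 0)
  have hlip : ∀ v w, |h v - h w| ≤ L * |v - w| := fun v w => by
    simpa using convex_univ.norm_image_sub_le_of_norm_hasDerivWithin_le
      (fun u _ => (hd u).hasDerivWithinAt) (fun u _ => hL u) (mem_univ w) (mem_univ v)
  have hcont : Continuous h := continuous_iff_continuousAt.2 fun w => (hd w).continuousAt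
  have hid : Integrable (fun t : ℝ => t) (gaussianReal 0 1) := IsGaussian.integrable_id
  have hint : Integrable h (gaussianReal 0 1) := by
    refine ((integrable_const |h 0|).add (hid.abs.const_mul L)).mono'
      hcont.aestronglyMeasurable (ae_of_all _ fun t => ?_)
    have := hlip t 0
    have h2 := abs_add_le (h t - h 0) (h 0)
    simp only [sub_add_cancel, sub_zero, norm_eq_abs, Pi.add_apply] at *
    linarith
  refine ⟨hint, ?_⟩
  set e := ∫ t, h t ∂(gaussianReal 0 1) with he
  -- Average the Lipschitz bound `|h w - h t| ≤ L (|w| + |t|)` over Gaussian `t`, using `E|t| ≤ 1`.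
  have hdev : ∀ w, |h w - e| ≤ L * |w| + L := by
    intro w
    have h1 : h w - e = ∫ t, (h w - h t) ∂(gaussianReal 0 1) := by
      rw [integral_sub (integrable_const _) hint]; simp [he]
    rw [h1]
    calc |∫ t, (h w - h t) ∂(gaussianReal 0 1)| ≤ ∫ t, |h w - h t| ∂(gaussianReal 0 1) :=
          abs_integral_le_integral_abs
      _ ≤ ∫ t, (L * |w| + L * |t|) ∂(gaussianReal 0 1) := by
          refine integral_mono ((integrable_const _).sub hint).abs
            ((integrable_const _).add (hid.abs.const_mul L)) fun t => ?_
          have := abs_sub w t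
          have h3 := hlip w t
          simp only
          nlinarith
      _ = L * |w| + L * ∫ t, |t| ∂(gaussianReal 0 1) := by
          rw [integral_add (integrable_const _) (hid.abs.const_mul L), integral_const,
            integral_const_mul]
          simp
      _ ≤ L * |w| + L := by nlinarith [integral_abs_gaussianReal_le]
  set q : ℝ → ℝ := fun t => (h t - e) * exp (-t ^ 2 / 2) with hq
  have hqc : Continuous q := by fun_prop
  have hqi : Integrable q :=
    (integrable_gaussianReal_zero_one_iff _).1 (hint.sub (integrable_const e))
  have hq0 : ∫ t, q t = 0 := by
    have := integral_gaussianReal_zero_one (fun t => h t - e)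
    rw [integral_sub hint (integrable_const _)] at this
    rw [integral_const, probReal_univ, one_smul, ← he, sub_self, eq_comm, mul_eq_zero] at this
    exact this.resolve_left (by positivity)
  set G : ℝ → ℝ := fun w => ∫ t in Iic w, q t with hGdef
  have hGeq : ∀ w, G w = G 0 + ∫ t in (0 : ℝ)..w, q t := fun w => by
    rw [intervalIntegral.integral_Iic_sub_Iic hqi.integrableOn hqi.integrableOn |>.symm]
    simp [hGdef]
  have hG : ∀ w, HasDerivAt G ((h w - e) * exp (-w ^ 2 / 2)) w := by
    intro w
    have : HasDerivAt (fun w => G 0 + ∫ t in (0 : ℝ)..w, q t) (q w) w :=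
      (intervalIntegral.integral_hasDerivAt_right (hqi.intervalIntegrable)
        (hqc.stronglyMeasurableAtFilter _ _) hqc.continuousAt).const_add _
    rw [show G = fun w => G 0 + ∫ t in (0 : ℝ)..w, q t from funext hGeq]
    exact this
  have hGtop : Tendsto G atTop (𝓝 0) := by
    have := tendsto_setIntegral_of_monotone (μ := volume) (f := q) (s := fun w : ℝ => Iic w)
      (fun _ => measurableSet_Iic) (fun a b hab => Iic_subset_Iic.2 hab)
      (by rw [iUnion_Iic]; exact hqi.integrableOn)
    rwa [iUnion_Iic, setIntegral_univ, hq0] at this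
  have hGbot : Tendsto G atBot (𝓝 0) := by
    -- Since `h - e` has Gaussian mean zero, the left tail integral is minus the right one.
    have h1 : ∀ w, G w = 0 - ∫ t in Ioi w, q t := fun w => by
      rw [← hq0, ← intervalIntegral.integral_Iic_add_Ioi hqi.integrableOn hqi.integrableOn (b := w)]
      simp [hGdef]
    have := tendsto_setIntegral_of_monotone (μ := volume) (f := q) (s := fun w : ℝ => Ioi (-w))
      (fun _ => measurableSet_Ioi) (fun a b hab => Ioi_subset_Ioi (neg_le_neg hab))
      (by exact hqi.integrableOn)
    have hU : (⋃ w : ℝ, Ioi (-w)) = univ := by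
      ext t; simp only [mem_iUnion, mem_Ioi, mem_univ, iff_true]; exact ⟨-t + 1, by linarith⟩
    rw [hU, setIntegral_univ, hq0] at this
    have h2 := this.comp tendsto_neg_atBot_atTop
    have h3 := h2.const_sub 0
    simp only [sub_zero] at h3
    refine h3.congr fun w => ?_
    rw [h1 w]; simp
  have hGb := abs_le_mul_exp_of_deriv hL0 hG hdev hGtop hGbot
  have hEinv : ∀ w : ℝ, exp (-w ^ 2 / 2) * exp (w ^ 2 / 2) = 1 := fun w => by
    rw [← exp_add]; simp [neg_div]
  have hexp : ∀ w : ℝ, HasDerivAt (fun w : ℝ => exp (w ^ 2 / 2)) (w * exp (w ^ 2 / 2)) w := by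
    intro w
    have h : HasDerivAt (fun w : ℝ => w ^ 2 / 2) w w := by
      exact ((hasDerivAt_pow 2 w).div_const 2).congr_deriv (by simp)
    exact h.exp.congr_deriv (by ring)
  set f : ℝ → ℝ := fun w => G w * exp (w ^ 2 / 2) with hf
  set f' : ℝ → ℝ := fun w => w * f w + (h w - e) with hf'
  have hfd : ∀ w, HasDerivAt f (f' w) w := by
    intro w
    refine ((hG w).mul (hexp w)).congr_deriv ?_
    simp only [hf', hf]
    rw [mul_assoc _ (exp (-w ^ 2 / 2)), hEinv]; ring
  have hfb : ∀ w, |f w| ≤ 3 * L := by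
    intro w
    have h1 := mul_le_mul_of_nonneg_right (hGb w) (exp_pos (w ^ 2 / 2)).le
    rw [mul_assoc, hEinv, mul_one] at h1
    simp only [hf, abs_mul, abs_of_pos (exp_pos (w ^ 2 / 2))]
    have h2 : 2 * L / (1 + |w|) ≤ 2 * L := div_le_self (by positivity) (by simp)
    linarith
  have hf'd : ∀ w, HasDerivAt f' (f w + w * f' w + h' w) w := by
    intro w
    exact (((hasDerivAt_id w).mul (hfd w)).add ((hd w).sub_const e)).congr_deriv (by simp)
  -- The equation gives `f'' = f + w f' + h'`, so `w f'` must be bounded. Multiplying `f'` by the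
  -- Gaussian weight cancels the `w f'` term, and the barrier applies again with `α = 0`, `γ = 4L`.
  set G2 : ℝ → ℝ := fun w => f' w * exp (-w ^ 2 / 2) with hG2
  have hG2d : ∀ w, HasDerivAt G2 ((f w + h' w) * exp (-w ^ 2 / 2)) w := by
    intro w
    refine ((hf'd w).mul (hasDerivAt_exp_neg_sq_half w)).congr_deriv ?_
    simp only [hf']
    ring
  have hG2b : ∀ w, |G2 w| ≤ 4 * L * (|w| * exp (-|w| ^ 2 / 2)) + L * exp (-|w| ^ 2 / 2) := by
    intro w
    simp only [hG2, abs_mul, abs_of_pos (exp_pos (-w ^ 2 / 2)), sq_abs]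
    have : |f' w| ≤ 4 * L * |w| + L := by
      have h1 := abs_add_le (w * f w) (h w - e)
      rw [abs_mul] at h1
      have h2 := mul_le_mul_of_nonneg_left (hfb w) (abs_nonneg w)
      have h3 := hdev w
      simp only [hf']
      linarith
    calc _ ≤ (4 * L * |w| + L) * exp (-w ^ 2 / 2) := by gcongr
      _ = _ := by ring
  have hlim : Tendsto (fun w : ℝ => 4 * L * (w * exp (-w ^ 2 / 2)) + L * exp (-w ^ 2 / 2))
      atTop (𝓝 0) := by
    simpa using (tendsto_mul_exp_neg_sq_half.const_mul (4 * L)).add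
      (tendsto_exp_neg_sq_half.const_mul L)
  have hG2top : Tendsto G2 atTop (𝓝 0) :=
    squeeze_zero_norm hG2b (hlim.comp tendsto_abs_atTop_atTop)
  have hG2bot : Tendsto G2 atBot (𝓝 0) :=
    squeeze_zero_norm hG2b (hlim.comp tendsto_abs_atBot_atTop)
  have hG2bd := abs_le_mul_exp_of_deriv (α := 0) (show 0 ≤ 4 * L by positivity) hG2d
    (fun w => by
      have h1 := abs_add_le (f w) (h' w)
      have h2 := hfb w
      have h3 := hL w
      linarith) hG2top hG2bot
  have hf'b : ∀ w, |w * f' w| ≤ 8 * L := by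
    intro w
    have h1 := mul_le_mul_of_nonneg_right (hG2bd w) (exp_pos (w ^ 2 / 2)).le
    rw [mul_assoc, hEinv, mul_one] at h1
    simp only [hG2, abs_mul, abs_of_pos (exp_pos (-w ^ 2 / 2)), mul_assoc, hEinv] at h1
    rw [abs_mul]
    have h2 := mul_le_mul_of_nonneg_left h1 (abs_nonneg w)
    have h3 : |w| / (1 + |w|) ≤ 1 := by
      rw [div_le_one (by positivity)]; linarith
    calc _ ≤ 8 * L * (|w| / (1 + |w|)) := by
          calc |w| * |f' w| = |w| * (|f' w| * 1) := by ring
            _ ≤ |w| * (0 + 2 * (4 * L) / (1 + |w|)) := h2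
            _ = 8 * L * (|w| / (1 + |w|)) := by ring
      _ ≤ 8 * L * 1 := by gcongr
      _ = _ := by ring
  -- The Lipschitz constant is `12 = 3 + 8 + 1`, from `f`, `w f'` and `h'`.
  refine ⟨f, f', hfd, fun w => by simp [hf'], hfb, fun v w => ?_⟩
  refine convex_univ.norm_image_sub_le_of_norm_hasDerivWithin_le
      (fun u _ => (hf'd u).hasDerivWithinAt) (C := 12 * L) (fun u _ => ?_) (mem_univ w) (mem_univ v)
  have h1 := abs_add_le (f u + u * f' u) (h' u)
  have h2 := abs_add_le (f u) (u * f' u)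
  have h3 := hfb u
  have h4 := hL u
  have h5 := hf'b u
  rw [norm_eq_abs]
  linarith

end Stein

/-! ### Leave-one-out expansion and comparison of expectations with the Gaussian case. -/

section LeaveOneOut

open Filter Topology Set Real

lemma ProbabilityTheory.iIndepFun.indepFun_sum_erase
    {Ω : Type*} [MeasurableSpace Ω] {P : Measure Ω} {n : ℕ} {X : Fin n → Ω → ℝ} (h : iIndepFun X P) (hm : ∀ k, Measurable (X k)) (c : Fin n → ℝ) (j : Fin n) :
    IndepFun (X j) (fun ω => ∑ k ∈ Finset.univ.erase j, c k * X k ω) P := by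
  have h2 := h.indepFun_finset {j} (Finset.univ.erase j) (by simp) hm
  have hφ : Measurable fun v : (({j} : Finset (Fin n)) → ℝ) =>
    v ⟨j, Finset.mem_singleton_self j⟩ := by fun_prop
  have hψ : Measurable fun v : (Finset.univ.erase j → ℝ) =>
    ∑ k : Finset.univ.erase j, c k * v k := by fun_prop
  have h3 := h2.comp hφ hψ
  convert h3 using 1
  · rfl
  · funext ω
    exact (Finset.sum_coe_sort (Finset.univ.erase j) fun k => c k * X k ω).symm

variable {Ω : Type*} [MeasurableSpace Ω] {P : Measure Ω} [IsProbabilityMeasure P]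

/-- Mean value inequality for `t ↦ F t - t F'(v)`; only a Lipschitz `F'` is needed, at the cost of
the factor `1/2`. -/
lemma abs_taylor_one_le {F F' : ℝ → ℝ} {M : ℝ} (hF : ∀ t, HasDerivAt F (F' t) t)
    (hlip : ∀ s t, |F' s - F' t| ≤ M * |s - t|) (v d : ℝ) :
    |F (v + d) - F v - d * F' v| ≤ M * d ^ 2 := by
  have hM : 0 ≤ M := by simpa using (abs_nonneg _).trans (hlip 1 0)
  have hd : ∀ t, HasDerivAt (fun t => F t - t * F' v) (F' t - F' v) t := fun t => by
    exact ((hF t).sub ((hasDerivAt_id t).mul_const (F' v))).congr_deriv (by simp)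
  have := (convex_uIcc v (v + d)).norm_image_sub_le_of_norm_hasDerivWithin_le
    (f := fun t => F t - t * F' v) (C := M * |d|)
    (fun t _ => (hd t).hasDerivWithinAt) (fun t ht => ?_) left_mem_uIcc right_mem_uIcc
  · rw [norm_eq_abs, norm_eq_abs, add_sub_cancel_left, mul_assoc, abs_mul_abs_self] at this
    calc _ = |F (v + d) - (v + d) * F' v - (F v - v * F' v)| := by congr 1; ring
      _ ≤ _ := this
      _ = _ := by ring
  · refine (hlip t v).trans (mul_le_mul_of_nonneg_left ?_ hM)
    have := abs_sub_left_of_mem_uIcc ht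
    simpa using this

lemma integrable_comp_of_lipschitz {F : ℝ → ℝ} {M : ℝ} (hlip : ∀ s t, |F s - F t| ≤ M * |s - t|)
    {V : Ω → ℝ} (hV : Integrable V P) : Integrable (fun ω => F (V ω)) P := by
  have hM : 0 ≤ M := by simpa using (abs_nonneg _).trans (hlip 1 0)
  have hc : Continuous F := by
    refine (LipschitzWith.of_dist_le_mul (K := M.toNNReal) fun s t => ?_).continuous
    simpa [Real.dist_eq, hM] using hlip s t
  refine ((integrable_const |F 0|).add (hV.abs.const_mul M)).mono'
    (hc.comp_aestronglyMeasurable hV.1) (ae_of_all _ fun ω => ?_)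
  have h1 := hlip (V ω) 0
  have h2 := abs_add_le (F (V ω) - F 0) (F 0)
  simp only [sub_add_cancel, sub_zero, norm_eq_abs, Pi.add_apply] at *
  linarith

lemma integral_abs_le_one {U : Ω → ℝ} (hU : MemLp U 2 P) (hU2 : ∫ ω, U ω ^ 2 ∂P = 1) :
    ∫ ω, |U ω| ∂P ≤ 1 := by
  have h3 : ∫ ω, |U ω| ∂P ≤ ∫ ω, (U ω ^ 2 + 1) / 2 ∂P := by
    refine integral_mono (hU.integrable one_le_two).abs
      ((hU.integrable_sq.add (integrable_const 1)).div_const 2) fun t => ?_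
    have := sq_nonneg (|U t| - 1)
    simp only
    nlinarith [sq_abs (U t)]
  rw [integral_div, integral_add hU.integrable_sq (integrable_const 1), hU2] at h3
  simpa using h3

/-- Approximate integration by parts for a centered variable of unit variance. -/
lemma abs_integral_mul_comp_sub_le {U V : Ω → ℝ} (hUV : IndepFun U V P) (hU : MemLp U 3 P)
    (hV : Integrable V P) (hU1 : ∫ ω, U ω ∂P = 0) (hU2 : ∫ ω, U ω ^ 2 ∂P = 1)
    {F F' : ℝ → ℝ} {M B : ℝ} (hF : ∀ t, HasDerivAt F (F' t) t) (hB : ∀ t, |F t| ≤ B)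
    (hlip : ∀ s t, |F' s - F' t| ≤ M * |s - t|) (c : ℝ) :
    |∫ ω, U ω * F (V ω + c * U ω) ∂P - c * ∫ ω, F' (V ω + c * U ω) ∂P|
      ≤ M * c ^ 2 * (∫ ω, |U ω| ^ 3 ∂P + 1) := by
  have hM : 0 ≤ M := by simpa using (abs_nonneg _).trans (hlip 1 0)
  have hUi : Integrable U P := hU.integrable (by norm_num)
  have hUL2 : MemLp U 2 P := hU.mono_exponent (by norm_num)
  have hU3 : Integrable (fun ω => |U ω| ^ 3) P := by
    simpa using hU.integrable_norm_pow (p := 3) (by norm_num)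
  have hFc : Continuous F := continuous_iff_continuousAt.2 fun w => (hF w).continuousAt
  have hF'c : Continuous F' := by
    refine (LipschitzWith.of_dist_le_mul (K := M.toNNReal) fun s t => ?_).continuous
    simpa [Real.dist_eq, hM] using hlip s t
  have hcU : Integrable (fun ω => c * U ω) P := hUi.const_mul c
  have hVU : Integrable (fun ω => V ω + c * U ω) P := hV.add hcU
  have hF'V : Integrable (fun ω => F' (V ω)) P := integrable_comp_of_lipschitz hlip hV
  have hF'VU : Integrable (fun ω => F' (V ω + c * U ω)) P := integrable_comp_of_lipschitz hlip hVU
  have hFV : Integrable (fun ω => F (V ω)) P :=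
    (integrable_const B).mono' (hFc.comp_aestronglyMeasurable hV.1) (ae_of_all _ fun ω => hB _)
  have i1 : Integrable (fun ω => U ω * F (V ω + c * U ω)) P :=
    hUi.mul_bdd (hFc.comp_aestronglyMeasurable hVU.1) (ae_of_all _ fun ω => hB _)
  have i2 : Integrable (fun ω => U ω * F (V ω)) P :=
    hUi.mul_bdd (hFc.comp_aestronglyMeasurable hV.1) (ae_of_all _ fun ω => hB _)
  -- The zeroth-order Taylor term vanishes because `U` is centred and independent of `V`; the
  -- first-order one becomes `c E F'(V)` because `E U² = 1`.
  have e2 : ∫ ω, U ω * F (V ω) ∂P = 0 := by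
    have h := (hUV.comp measurable_id hFc.measurable).integral_fun_mul_eq_mul_integral
      hUi.1 hFV.1
    simp only [Function.comp_apply, id] at h
    rw [h, hU1, zero_mul]
  have hind : IndepFun (fun ω => U ω ^ 2) (fun ω => F' (V ω)) P :=
    hUV.comp (measurable_id.pow_const 2) hF'c.measurable
  have i3 : Integrable (fun ω => U ω ^ 2 * F' (V ω)) P :=
    hind.integrable_mul hUL2.integrable_sq hF'V
  have e3 : ∫ ω, U ω ^ 2 * F' (V ω) ∂P = ∫ ω, F' (V ω) ∂P := by
    rw [hind.integral_fun_mul_eq_mul_integral hUL2.integrable_sq.1 hF'V.1, hU2, one_mul]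
  have b1 : |∫ ω, (U ω * F (V ω + c * U ω) - U ω * F (V ω) - c * (U ω ^ 2 * F' (V ω))) ∂P|
      ≤ M * c ^ 2 * ∫ ω, |U ω| ^ 3 ∂P := by
    rw [← integral_const_mul]
    refine abs_integral_le_integral_abs.trans (integral_mono
      ((i1.sub i2).sub (i3.const_mul c)).abs (hU3.const_mul _) fun ω => ?_)
    have h := abs_taylor_one_le hF hlip (V ω) (c * U ω)
    calc |U ω * F (V ω + c * U ω) - U ω * F (V ω) - c * (U ω ^ 2 * F' (V ω))|
        = |U ω| * |F (V ω + c * U ω) - F (V ω) - c * U ω * F' (V ω)| := by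
          rw [← abs_mul]; congr 1; ring
      _ ≤ |U ω| * (M * (c * U ω) ^ 2) := by gcongr
      _ = M * c ^ 2 * |U ω| ^ 3 := by rw [mul_pow, ← sq_abs (U ω)]; ring
  have i12 : Integrable (fun ω => U ω * F (V ω + c * U ω) - U ω * F (V ω)) P := i1.sub i2
  rw [integral_sub i12 (i3.const_mul c), integral_sub i1 i2, e2, integral_const_mul, e3,
    sub_zero] at b1
  -- Put `c U` back into the argument of `F'`; this accounts for the `+ 1` next to the third moment.
  have b2 : |∫ ω, (F' (V ω) - F' (V ω + c * U ω)) ∂P| ≤ M * |c| := by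
    calc _ ≤ ∫ ω, M * |c| * |U ω| ∂P := by
          refine abs_integral_le_integral_abs.trans (integral_mono
            (hF'V.sub hF'VU).abs (hUi.abs.const_mul _) fun ω => ?_)
          have := hlip (V ω) (V ω + c * U ω)
          rw [sub_add_cancel_left, abs_neg, abs_mul] at this
          simpa [mul_assoc] using this
      _ = M * |c| * ∫ ω, |U ω| ∂P := integral_const_mul _ _
      _ ≤ M * |c| * 1 := by
          gcongr
          exact integral_abs_le_one hUL2 hU2
      _ = _ := mul_one _
  rw [integral_sub hF'V hF'VU] at b2
  set x1 := ∫ ω, U ω * F (V ω + c * U ω) ∂P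
  set x2 := ∫ ω, F' (V ω + c * U ω) ∂P
  set x3 := ∫ ω, F' (V ω) ∂P
  calc |x1 - c * x2| = |(x1 - c * x3) + c * (x3 - x2)| := by congr 1; ring
    _ ≤ |x1 - c * x3| + |c| * |x3 - x2| := by rw [← abs_mul]; exact abs_add_le _ _
    _ ≤ M * c ^ 2 * ∫ ω, |U ω| ^ 3 ∂P + |c| * (M * |c|) := by gcongr
    _ = _ := by rw [← sq_abs c]; ring

variable {n : ℕ}

lemma abs_coord_le_coordSupNorm (x : EuclideanSpace ℝ (Fin n)) (j : Fin n) :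
    |x j| ≤ coordSupNorm x :=
  le_ciSup (f := fun j => |x j|) (Set.finite_range _).bddAbove j

/-- One factor `|x_j|` is bounded by the maximum and the rest goes to Cauchy–Schwarz. This is the
source of `‖x‖_∞` in the final error. -/
lemma sum_abs_mul_sq_le (x z : EuclideanSpace ℝ (Fin n)) :
    ∑ j, |z j| * x j ^ 2 ≤ coordSupNorm x * (‖z‖ * ‖x‖) := by
  have h1 : ∑ j, |z j| * |x j| ≤ ‖z‖ * ‖x‖ := by
    rw [EuclideanSpace.norm_eq, EuclideanSpace.norm_eq]
    simpa using Real.sum_mul_le_sqrt_mul_sqrt Finset.univ (fun j => |z j|) (fun j => |x j|)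
  have hs : 0 ≤ coordSupNorm x := Real.iSup_nonneg fun j => abs_nonneg _
  calc _ ≤ ∑ j, coordSupNorm x * (|z j| * |x j|) := by
        refine Finset.sum_le_sum fun j _ => ?_
        rw [← sq_abs (x j)]
        have := abs_coord_le_coordSupNorm x j
        have h2 : 0 ≤ |z j| * |x j| := by positivity
        nlinarith
    _ = coordSupNorm x * ∑ j, |z j| * |x j| := by rw [Finset.mul_sum]
    _ ≤ _ := by gcongr

/-- Random vectors with independent standardized coordinates and third moments at most `ρ`. -/
structure HasStandardCoords (X : Ω → EuclideanSpace ℝ (Fin n)) (P : Measure Ω) (ρ : ℝ) : Prop where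
  measurable : Measurable X
  indep : iIndepFun (fun j ω => X ω j) P
  memLp : ∀ j, MemLp (fun ω => X ω j) 3 P
  mean : ∀ j, ∫ ω, X ω j ∂P = 0
  var : ∀ j, ∫ ω, X ω j ^ 2 ∂P = 1
  third : ∀ j, ∫ ω, |X ω j| ^ 3 ∂P ≤ ρ

lemma HasStandardCoords.integrable_inner {X : Ω → EuclideanSpace ℝ (Fin n)} {ρ : ℝ}
    (hX : HasStandardCoords X P ρ) (x : EuclideanSpace ℝ (Fin n)) :
    Integrable (fun ω => (inner ℝ (X ω) x : ℝ)) P := by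
  simp only [PiLp.inner_apply]
  exact integrable_finsetSum _ fun j _ =>
    ((hX.memLp j).integrable (by norm_num)).const_mul (x j)

/-- For each `j`, write `⟨X, x⟩ = V + x_j X_j` with `V` independent of `X_j` and integrate by parts
approximately in `X_j`; the errors `x_j²` are then summed with weights `|z_j|`. -/
lemma HasStandardCoords.abs_integral_comp_mul_inner_sub_le {X : Ω → EuclideanSpace ℝ (Fin n)}
    {ρ : ℝ} (hX : HasStandardCoords X P ρ) {F F' : ℝ → ℝ} {M B : ℝ}
    (hF : ∀ t, HasDerivAt F (F' t) t) (hB : ∀ t, |F t| ≤ B)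
    (hlip : ∀ s t, |F' s - F' t| ≤ M * |s - t|) (x z : EuclideanSpace ℝ (Fin n)) :
    |∫ ω, F (inner ℝ (X ω) x) * inner ℝ (X ω) z ∂P -
        inner ℝ x z * ∫ ω, F' (inner ℝ (X ω) x) ∂P|
      ≤ M * (ρ + 1) * (coordSupNorm x * (‖z‖ * ‖x‖)) := by
  have hM : 0 ≤ M := by simpa using (abs_nonneg _).trans (hlip 1 0)
  have hXi : ∀ j, Integrable (fun ω => X ω j) P := fun j => (hX.memLp j).integrable (by norm_num)
  have hFc : Continuous F := continuous_iff_continuousAt.2 fun w => (hF w).continuousAt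
  have hcoord : ∀ j, |∫ ω, X ω j * F (inner ℝ (X ω) x) ∂P -
      x j * ∫ ω, F' (inner ℝ (X ω) x) ∂P| ≤ M * x j ^ 2 * (ρ + 1) := by
    intro j
    set V : Ω → ℝ := fun ω => ∑ k ∈ Finset.univ.erase j, x k * X ω k with hV
    have hS : ∀ ω, (inner ℝ (X ω) x : ℝ) = V ω + x j * X ω j := fun ω => by
      simp [PiLp.inner_apply, hV, Finset.sum_erase_eq_sub]
    have hind : IndepFun (fun ω => X ω j) V P := by
      exact hX.indep.indepFun_sum_erase (fun k => by
        have := hX.measurable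
        fun_prop) x j
    have hVi : Integrable V P := integrable_finsetSum _ fun k _ => (hXi k).const_mul _
    simp_rw [hS]
    refine (abs_integral_mul_comp_sub_le hind (hX.memLp j) hVi (hX.mean j) (hX.var j) hF hB hlip
      (x j)).trans ?_
    have := hX.third j
    gcongr
  have hi : ∀ j, Integrable (fun ω => X ω j * F (inner ℝ (X ω) x)) P := fun j =>
    (hXi j).mul_bdd (hFc.comp_aestronglyMeasurable (hX.integrable_inner x).1)
      (ae_of_all _ fun ω => hB _)
  have e1 : ∫ ω, F (inner ℝ (X ω) x) * inner ℝ (X ω) z ∂P =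
      ∑ j, z j * ∫ ω, X ω j * F (inner ℝ (X ω) x) ∂P := by
    simp_rw [← integral_const_mul]
    rw [← integral_finsetSum _ fun j _ => (hi j).const_mul _]
    refine integral_congr_ae (ae_of_all _ fun ω => ?_)
    simp only [PiLp.inner_apply (X ω) z, Finset.mul_sum]
    refine Finset.sum_congr rfl fun j _ => ?_
    simp
    ring
  have e2 : inner ℝ x z * ∫ ω, F' (inner ℝ (X ω) x) ∂P =
      ∑ j, z j * (x j * ∫ ω, F' (inner ℝ (X ω) x) ∂P) := by
    simp [PiLp.inner_apply x z, Finset.sum_mul, mul_assoc]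
  rw [e1, e2, ← Finset.sum_sub_distrib]
  -- The sign of `ρ + 1` is only forced by the third moment of some coordinate, so dimension 0 is
  -- separate.
  have hρ : 0 ≤ M * (ρ + 1) ∨ n = 0 := by
    rcases Nat.eq_zero_or_pos n with h | h
    · exact Or.inr h
    · left
      have := (integral_nonneg fun ω => by positivity).trans (hX.third ⟨0, h⟩)
      positivity
  rcases hρ with hρ | rfl
  · calc _ ≤ ∑ j, |z j * ∫ ω, X ω j * F (inner ℝ (X ω) x) ∂P -
          z j * (x j * ∫ ω, F' (inner ℝ (X ω) x) ∂P)| := Finset.abs_sum_le_sum_abs _ _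
      _ ≤ ∑ j, M * (ρ + 1) * (|z j| * x j ^ 2) := by
          refine Finset.sum_le_sum fun j _ => ?_
          rw [← mul_sub, abs_mul]
          calc _ ≤ |z j| * (M * x j ^ 2 * (ρ + 1)) := by gcongr; exact hcoord j
            _ = _ := by ring
      _ ≤ _ := by
          rw [← Finset.mul_sum]
          gcongr
          exact sum_abs_mul_sq_le x z
  · simp [coordSupNorm]

/-- The difference of the integrands, times the Gaussian weight, is the derivative of `F t * exp (-t
^ 2 / 2)`, which vanishes at both ends since `F` is bounded. -/
lemma integral_mul_id_gaussianReal {F F' : ℝ → ℝ} {B : ℝ} (hF : ∀ t, HasDerivAt F (F' t) t)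
    (hB : ∀ t, |F t| ≤ B) (hint : Integrable F' (gaussianReal 0 1)) :
    ∫ t, F t * t ∂(gaussianReal 0 1) = ∫ t, F' t ∂(gaussianReal 0 1) := by
  have hFc : Continuous F := continuous_iff_continuousAt.2 fun w => (hF w).continuousAt
  have hid : Integrable (fun t : ℝ => t) (gaussianReal 0 1) := IsGaussian.integrable_id
  have hi : Integrable (fun t => F t * t) (gaussianReal 0 1) :=
    hid.bdd_mul hFc.aestronglyMeasurable (ae_of_all _ hB)
  rw [eq_comm, ← sub_eq_zero, ← integral_sub hint hi, integral_gaussianReal_zero_one]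
  have hd : ∀ t, HasDerivAt (fun t => F t * exp (-t ^ 2 / 2))
      ((F' t - F t * t) * exp (-t ^ 2 / 2)) t := fun t =>
    ((hF t).mul (hasDerivAt_exp_neg_sq_half t)).congr_deriv (by ring)
  have hb : ∀ t, ‖F t * exp (-t ^ 2 / 2)‖ ≤ B * exp (-|t| ^ 2 / 2) := fun t => by
    rw [norm_mul, sq_abs, norm_eq_abs, norm_eq_abs, abs_of_pos (exp_pos _)]
    gcongr
    exact hB t
  have hlim : Tendsto (fun t : ℝ => B * exp (-t ^ 2 / 2)) atTop (𝓝 0) := by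
    simpa using tendsto_exp_neg_sq_half.const_mul B
  rw [integral_of_hasDerivAt_of_tendsto hd
    ((integrable_gaussianReal_zero_one_iff _).1 (hint.sub hi))
    (squeeze_zero_norm hb (hlim.comp tendsto_abs_atBot_atTop))
    (squeeze_zero_norm hb (hlim.comp tendsto_abs_atTop_atTop))]
  simp

/-- The expectation of the objective function is close to the one for Gaussian measurements. -/
theorem HasStandardCoords.abs_integral_sub_gaussian_le {X : Ω → EuclideanSpace ℝ (Fin n)} {ρ : ℝ}
    (hX : HasStandardCoords X P ρ) {θ θ' θ'' : ℝ → ℝ} {τ : ℝ}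
    (hθ : ∀ t, |θ t| ≤ 1) (hd : ∀ t, HasDerivAt θ (θ' t) t) (hd' : ∀ t, HasDerivAt θ' (θ'' t) t)
    (hτ : ∀ t, |θ'' t| ≤ τ) {x : EuclideanSpace ℝ (Fin n)} (hx : ‖x‖ = 1)
    (z : EuclideanSpace ℝ (Fin n)) :
    |∫ ω, θ (inner ℝ (X ω) x) * inner ℝ (X ω) z ∂P -
        (∫ t, θ t * t ∂(gaussianReal 0 1)) * inner ℝ x z|
      ≤ 13 * τ * (ρ + 1) * coordSupNorm x * ‖z‖ := by
  obtain ⟨hint, f, f', hf, hstein, hfb, hflip⟩ := exists_stein_solution hd' hτ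
  have hlip : ∀ v w, |θ' v - θ' w| ≤ τ * |v - w| := fun v w => by
    simpa using convex_univ.norm_image_sub_le_of_norm_hasDerivWithin_le
      (fun u _ => (hd' u).hasDerivWithinAt) (fun u _ => hτ u) (mem_univ w) (mem_univ v)
  have h1 := hX.abs_integral_comp_mul_inner_sub_le hd hθ hlip x z
  -- With `F = f` and `z = x`, the compared quantity is `E[S f(S) - f'(S)]` for `S = ⟨X, x⟩`, which
  -- Stein's equation turns into `λ - E θ'(S)`.
  have h2 := hX.abs_integral_comp_mul_inner_sub_le hf hfb hflip x x
  have hS := hX.integrable_inner x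
  have hfc : Continuous f := continuous_iff_continuousAt.2 fun w => (hf w).continuousAt
  rw [integral_mul_id_gaussianReal hd hθ hint]
  set lam := ∫ t, θ' t ∂(gaussianReal 0 1) with hlam
  set I := ∫ ω, θ (inner ℝ (X ω) x) * inner ℝ (X ω) z ∂P
  set J := ∫ ω, θ' (inner ℝ (X ω) x) ∂P with hJ
  have e : ∫ ω, f (inner ℝ (X ω) x) * inner ℝ (X ω) x ∂P -
      ∫ ω, f' (inner ℝ (X ω) x) ∂P = lam - J := by
    have hθ'i := integrable_comp_of_lipschitz hlip hS
    rw [← integral_sub (hS.bdd_mul (hfc.comp_aestronglyMeasurable hS.1)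
      (ae_of_all _ fun ω => hfb _)) (integrable_comp_of_lipschitz hflip hS)]
    have : lam - J = ∫ ω, (lam - θ' (inner ℝ (X ω) x)) ∂P := by
      rw [integral_sub (integrable_const _) hθ'i]; simp [hJ]
    rw [this]
    refine integral_congr_ae (ae_of_all _ fun ω => ?_)
    have := hstein (inner ℝ (X ω) x)
    simp only
    linarith
  rw [real_inner_self_eq_norm_sq, hx, one_pow, one_mul, e, mul_one, mul_one] at h2
  rw [hx, mul_one] at h1
  have h3 : |(inner ℝ x z : ℝ)| ≤ ‖z‖ := by simpa [hx] using abs_real_inner_le_norm x z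
  calc |I - lam * inner ℝ x z| = |(I - inner ℝ x z * J) + inner ℝ x z * (J - lam)| := by
        congr 1; ring
    _ ≤ |I - inner ℝ x z * J| + |(inner ℝ x z : ℝ)| * |lam - J| := by
        rw [abs_sub_comm lam J, ← abs_mul]; exact abs_add_le _ _
    _ ≤ τ * (ρ + 1) * (coordSupNorm x * ‖z‖) +
        ‖z‖ * (12 * τ * (ρ + 1) * coordSupNorm x) := by
        gcongr
    _ = _ := by ring

end LeaveOneOut

/-! ### Convex domination of measures. -/

section ConvexOrder

open Filter Topology Set Real

variable {Ω : Type*} [MeasurableSpace Ω] {P : Measure Ω}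

lemma ConvexOn.comp_const_add {E : Type*} [NormedAddCommGroup E] [NormedSpace ℝ E]
    {Φ : E → ℝ} (hΦ : ConvexOn ℝ univ Φ) (c : E) :
    ConvexOn ℝ univ fun u => Φ (c + u) := by
  have := hΦ.translate_right c
  simpa [Function.comp_def] using this

/-- Jensen with a lower integral on the right: either that integral is infinite, or `Φ ∘ f` is
integrable and the usual inequality applies. -/
lemma ofReal_map_integral_le {E : Type*} [NormedAddCommGroup E] [NormedSpace ℝ E] [CompleteSpace E]
    [IsProbabilityMeasure P] {Φ : E → ℝ}
    (hΦ : ConvexOn ℝ univ Φ) (hc : Continuous Φ) (h0 : ∀ u, 0 ≤ Φ u) {f : Ω → E}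
    (hf : Integrable f P) :
    ENNReal.ofReal (Φ (∫ ω, f ω ∂P)) ≤ ∫⁻ ω, ENNReal.ofReal (Φ (f ω)) ∂P := by
  by_cases htop : ∫⁻ ω, ENNReal.ofReal (Φ (f ω)) ∂P = ∞
  · rw [htop]; exact le_top
  have hi : Integrable (fun ω => Φ (f ω)) P := by
    refine ⟨hc.comp_aestronglyMeasurable hf.1, ?_⟩
    rw [hasFiniteIntegral_iff_ofReal (ae_of_all _ fun ω => h0 _)]
    exact lt_top_iff_ne_top.2 htop
  rw [← ofReal_integral_eq_lintegral_ofReal hi (ae_of_all _ fun ω => h0 _)]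
  exact ENNReal.ofReal_le_ofReal
    (hΦ.map_integral_le hc.continuousOn isClosed_univ (by simp) hf hi)

/-- `ν` dominates `μ` on nonnegative continuous convex functions. -/
def ConvexDominated {E : Type*} [NormedAddCommGroup E] [NormedSpace ℝ E] [MeasurableSpace E]
    (μ ν : Measure E) : Prop :=
  ∀ Φ : E → ℝ, ConvexOn ℝ univ Φ → Continuous Φ → (∀ u, 0 ≤ Φ u) →
    ∫⁻ u, ENNReal.ofReal (Φ u) ∂μ ≤ ∫⁻ u, ENNReal.ofReal (Φ u) ∂ν

variable {E F : Type*} [NormedAddCommGroup E] [NormedSpace ℝ E] [MeasurableSpace E] [BorelSpace E]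
  [NormedAddCommGroup F] [NormedSpace ℝ F] [MeasurableSpace F] [BorelSpace F]
  {μ μ' ν ν' : Measure E}

lemma ConvexDominated.map (h : ConvexDominated μ ν) (T : E →L[ℝ] F) :
    ConvexDominated (μ.map T) (ν.map T) := by
  intro Φ hΦ hc h0
  have hm : Measurable fun u => ENNReal.ofReal (Φ u) := hc.measurable.ennreal_ofReal
  rw [lintegral_map hm (by fun_prop), lintegral_map hm (by fun_prop)]
  exact h (fun u => Φ (T u)) (hΦ.comp_linearMap T.toLinearMap) (by fun_prop) fun u => h0 _

/-- Translates of convex functions are convex, so the two factors can be replaced one at a time,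
with Tonelli in between. -/
lemma ConvexDominated.conv [SecondCountableTopology E] [SFinite μ] [SFinite μ'] [SFinite ν]
    [SFinite ν'] (h : ConvexDominated μ ν) (h' : ConvexDominated μ' ν') :
    ConvexDominated (μ ∗ μ') (ν ∗ ν') := by
  intro Φ hΦ hc h0
  have hm : Measurable fun u => ENNReal.ofReal (Φ u) := hc.measurable.ennreal_ofReal
  have hm2 : Measurable fun p : E × E => ENNReal.ofReal (Φ (p.1 + p.2)) := by fun_prop
  rw [Measure.lintegral_conv hm, Measure.lintegral_conv hm]
  calc ∫⁻ x, ∫⁻ y, ENNReal.ofReal (Φ (x + y)) ∂μ' ∂μ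
      ≤ ∫⁻ x, ∫⁻ y, ENNReal.ofReal (Φ (x + y)) ∂ν' ∂μ :=
        lintegral_mono fun x => h' (fun u => Φ (x + u)) (ConvexOn.comp_const_add hΦ x)
          (by fun_prop) fun u => h0 _
    _ = ∫⁻ y, ∫⁻ x, ENNReal.ofReal (Φ (x + y)) ∂μ ∂ν' := lintegral_lintegral_swap hm2.aemeasurable
    _ ≤ ∫⁻ y, ∫⁻ x, ENNReal.ofReal (Φ (x + y)) ∂ν ∂ν' := by
        refine lintegral_mono fun y => ?_
        simp_rw [add_comm _ y]
        exact h (fun u => Φ (y + u)) (ConvexOn.comp_const_add hΦ y) (by fun_prop) fun u => h0 _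
    _ = ∫⁻ x, ∫⁻ y, ENNReal.ofReal (Φ (x + y)) ∂ν' ∂ν :=
        (lintegral_lintegral_swap hm2.aemeasurable).symm

lemma ConvexDominated.sum [SecondCountableTopology E] [IsProbabilityMeasure P]
    {Ω' : Type*} [MeasurableSpace Ω'] {Q : Measure Ω'} [IsProbabilityMeasure Q]
    {ι : Type*} {X : ι → Ω → E} {Y : ι → Ω' → E} (hX : iIndepFun X P) (hY : iIndepFun Y Q)
    (hXm : ∀ i, Measurable (X i)) (hYm : ∀ i, Measurable (Y i))
    (h : ∀ i, ConvexDominated (P.map (X i)) (Q.map (Y i))) (s : Finset ι) :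
    ConvexDominated (P.map (∑ i ∈ s, X i)) (Q.map (∑ i ∈ s, Y i)) := by
  classical
  induction s using Finset.induction_on with
  | empty => simp [Pi.zero_def, ConvexDominated]
  | insert j s hj ih =>
    rw [Finset.sum_insert hj, Finset.sum_insert hj,
      (hX.indepFun_finsetSum_of_notMem hXm hj).symm.map_add_eq_map_conv_map (hXm j)
        (by rw [Finset.sum_fn]; exact Finset.measurable_sum _ fun i _ => hXm i),
      (hY.indepFun_finsetSum_of_notMem hYm hj).symm.map_add_eq_map_conv_map (hYm j)
        (by rw [Finset.sum_fn]; exact Finset.measurable_sum _ fun i _ => hYm i)]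
    exact (h j).conv ih

/-- Symmetrization of a random vector known up to sign. -/
lemma ConvexDominated.symmetrization [CompleteSpace E] [SecondCountableTopology E]
    [IsProbabilityMeasure P] {Z V : Ω → E} (hZm : Measurable Z) (hVm : Measurable V)
    (hZi : Integrable Z P) (hZV : ∀ ω, Z ω = V ω ∨ Z ω = -V ω)
    (hν : ν.map Neg.neg = ν) (h : ConvexDominated (P.map fun ω => (2 : ℝ) • V ω) ν) :
    ConvexDominated (P.map fun ω => Z ω - ∫ ω, Z ω ∂P) ν := by
  intro Φ hΦ hc h0
  have hm : Measurable fun u => ENNReal.ofReal (Φ u) := hc.measurable.ennreal_ofReal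
  have hneg : ConvexOn ℝ univ fun u => Φ (-u) :=
    hΦ.comp_linearMap (-LinearMap.id : E →ₗ[ℝ] E)
  have h1 := h Φ hΦ hc h0
  have h2 := h (fun u => Φ (-u)) hneg (by fun_prop) fun u => h0 _
  rw [lintegral_map hm (by fun_prop)] at h1
  rw [lintegral_map (by fun_prop) (by fun_prop)] at h2
  have h3 : ∫⁻ u, ENNReal.ofReal (Φ (-u)) ∂ν = ∫⁻ u, ENNReal.ofReal (Φ u) ∂ν := by
    conv_rhs => rw [← hν]
    rw [lintegral_map hm measurable_neg]
  rw [h3] at h2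
  rw [lintegral_map hm (by fun_prop)]
  set a : Ω → ℝ≥0∞ := fun ω => ENNReal.ofReal (Φ ((2 : ℝ) • Z ω))
  set b : Ω → ℝ≥0∞ := fun ω => ENNReal.ofReal (Φ (-((2 : ℝ) • Z ω)))
  have ham : Measurable a := by fun_prop
  have hbm : Measurable b := by fun_prop
  -- Replace the mean by an independent copy `Z'` through Jensen, then use convexity at `Z - Z' = ½
  -- (2Z) + ½ (-2Z')`.
  have key : ∀ ω, ENNReal.ofReal (Φ (Z ω - ∫ ω, Z ω ∂P)) ≤
      2⁻¹ * (a ω + ∫⁻ ω', b ω' ∂P) := by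
    intro ω
    have e : Z ω - ∫ ω, Z ω ∂P = ∫ ω', (Z ω - Z ω') ∂P := by
      rw [integral_sub (integrable_const _) hZi]; simp
    rw [e]
    refine (ofReal_map_integral_le hΦ hc h0 ((integrable_const _).sub hZi)).trans ?_
    calc ∫⁻ ω', ENNReal.ofReal (Φ (Z ω - Z ω')) ∂P
        ≤ ∫⁻ ω', 2⁻¹ * (a ω + b ω') ∂P := by
          refine lintegral_mono fun ω' => ?_
          have := hΦ.2 (mem_univ ((2 : ℝ) • Z ω)) (mem_univ (-((2 : ℝ) • Z ω')))
            (show (0 : ℝ) ≤ 2⁻¹ by norm_num) (show (0 : ℝ) ≤ 2⁻¹ by norm_num) (by norm_num)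
          rw [smul_neg, smul_smul, smul_smul, inv_mul_cancel₀ two_ne_zero, one_smul, one_smul,
            ← sub_eq_add_neg, smul_eq_mul, smul_eq_mul, ← mul_add] at this
          refine (ENNReal.ofReal_le_ofReal this).trans_eq ?_
          rw [ENNReal.ofReal_mul (by norm_num), ENNReal.ofReal_add (h0 _) (h0 _),
            ENNReal.ofReal_inv_of_pos two_pos]
          simp [a, b]
      _ = _ := by
          rw [lintegral_const_mul _ (by fun_prop), lintegral_add_left (by fun_prop)]
          simp
  calc _ ≤ ∫⁻ ω, 2⁻¹ * (a ω + ∫⁻ ω', b ω' ∂P) ∂P := lintegral_mono key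
    _ = 2⁻¹ * ∫⁻ ω, (a ω + b ω) ∂P := by
        rw [lintegral_const_mul _ (by fun_prop), lintegral_add_left ham, lintegral_add_left ham]
        simp
    _ = 2⁻¹ * ∫⁻ ω, (ENNReal.ofReal (Φ ((2 : ℝ) • V ω)) +
          ENNReal.ofReal (Φ (-((2 : ℝ) • V ω)))) ∂P := by
        congr 1
        refine lintegral_congr fun ω => ?_
        -- The unknown sign only swaps the two summands.
        rcases hZV ω with h | h
        · simp [a, b, h]
        · simp [a, b, h, add_comm]
    _ ≤ 2⁻¹ * (∫⁻ u, ENNReal.ofReal (Φ u) ∂ν + ∫⁻ u, ENNReal.ofReal (Φ u) ∂ν) := by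
        rw [lintegral_add_left (by fun_prop)]
        gcongr
    _ = _ := by
        rw [← two_mul, ← mul_assoc, ENNReal.inv_mul_cancel (by simp) (by simp), one_mul]

end ConvexOrder

/-! ### From sub-gaussian tails to Gaussian domination on the line. -/

section ScalarConvexOrder

open Filter Topology Set Real

/-- Symmetric measures whose tails compare are comparable in the convex order. -/
theorem ConvexDominated.of_tail {μ ν : Measure ℝ} [IsProbabilityMeasure μ] [IsProbabilityMeasure ν]
    (hμ : μ.map Neg.neg = μ) (hν : ν.map Neg.neg = ν) {K : ℝ} (hK : 1 ≤ K)
    (h : ∀ t, 0 ≤ t → μ {u | t < |u|} ≤ ENNReal.ofReal K * ν {u | t < |u|}) :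
    ConvexDominated μ (ν.map (fun u => K * u)) := by
  intro Φ hΦ hc h0
  have hm : Measurable fun u => ENNReal.ofReal (Φ u) := hc.measurable.ennreal_ofReal
  -- Against symmetric measures `Φ` may be replaced by its even part; subtracting `Φ 0` leaves an
  -- even convex function that vanishes at 0 and increases on the half-line.
  set ψ : ℝ → ℝ := fun u => (Φ u + Φ (-u)) / 2 - Φ 0 with hψ
  have hneg : ConvexOn ℝ univ fun u => Φ (-u) :=
    hΦ.comp_linearMap (-LinearMap.id : ℝ →ₗ[ℝ] ℝ)
  have hψ0 : ψ 0 = 0 := by simp [hψ]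
  have hψc : Continuous ψ := by fun_prop
  have hψm : Measurable fun u => ENNReal.ofReal (ψ u) := hψc.measurable.ennreal_ofReal
  have hψe : ∀ u, ψ |u| = ψ u := fun u => by
    rcases abs_cases u with ⟨hu, _⟩ | ⟨hu, _⟩ <;> simp [hψ, hu, add_comm]
  have hstar : ∀ c u, 0 ≤ c → c ≤ 1 → ψ (c * u) ≤ c * ψ u := by
    intro c u hc0 hc1
    have h1 := hΦ.2 (mem_univ u) (mem_univ 0) hc0 (sub_nonneg.2 hc1) (by ring)
    have h2 := hneg.2 (mem_univ u) (mem_univ 0) hc0 (sub_nonneg.2 hc1) (by ring)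
    simp only [smul_eq_mul, mul_zero, add_zero, neg_zero] at h1 h2
    simp only [hψ]
    linarith
  have hψnn : ∀ u, 0 ≤ ψ u := fun u => by
    have := hΦ.2 (mem_univ u) (mem_univ (-u)) (show (0 : ℝ) ≤ 2⁻¹ by norm_num)
      (show (0 : ℝ) ≤ 2⁻¹ by norm_num) (by norm_num)
    simp only [smul_eq_mul, mul_neg, add_neg_cancel] at this
    simp only [hψ]
    linarith
  have hmono : ∀ s t, 0 ≤ s → s ≤ t → ψ s ≤ ψ t := by
    intro s t hs hst
    rcases hs.eq_or_lt with rfl | hs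
    · rw [hψ0]; exact hψnn t
    have ht : 0 < t := hs.trans_le hst
    have h1 := hstar (s / t) t (by positivity) (by rw [div_le_one ht]; exact hst)
    rw [div_mul_cancel₀ _ ht.ne'] at h1
    refine h1.trans (mul_le_of_le_one_left (hψnn t) (by rw [div_le_one ht]; exact hst))
  have hsymm : ∀ ρ : Measure ℝ, IsProbabilityMeasure ρ → ρ.map Neg.neg = ρ →
      ∫⁻ u, ENNReal.ofReal (Φ u) ∂ρ = ENNReal.ofReal (Φ 0) + ∫⁻ u, ENNReal.ofReal (ψ u) ∂ρ := by
    intro ρ _ hρ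
    have h3 : ∫⁻ u, ENNReal.ofReal (Φ (-u)) ∂ρ = ∫⁻ u, ENNReal.ofReal (Φ u) ∂ρ := by
      conv_rhs => rw [← hρ]
      rw [lintegral_map hm measurable_neg]
    have h4 : ∫⁻ u, ENNReal.ofReal (Φ u) ∂ρ =
        ∫⁻ u, 2⁻¹ * (ENNReal.ofReal (Φ u) + ENNReal.ofReal (Φ (-u))) ∂ρ := by
      rw [lintegral_const_mul _ (by fun_prop), lintegral_add_left hm, h3, ← two_mul, ← mul_assoc,
        ENNReal.inv_mul_cancel (by simp) (by simp), one_mul]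
    have h5 : ENNReal.ofReal (Φ 0) = ∫⁻ _, ENNReal.ofReal (Φ 0) ∂ρ := by simp
    rw [h4, h5, ← lintegral_add_left measurable_const]
    refine lintegral_congr fun u => ?_
    rw [← ENNReal.ofReal_add (h0 _) (hψnn _), ← ENNReal.ofReal_add (h0 _) (h0 _),
      show (2 : ℝ≥0∞)⁻¹ = ENNReal.ofReal 2⁻¹ by rw [ENNReal.ofReal_inv_of_pos two_pos]; simp,
      ← ENNReal.ofReal_mul (by norm_num)]
    congr 1
    simp only [hψ]
    ring
  have htail : ∀ r, 0 < r → μ {u | r < ψ u} ≤ ENNReal.ofReal K * ν {u | r < ψ u} := by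
    intro r hr
    by_cases hex : ∃ u, r < ψ u
    · obtain ⟨u₀, hu₀⟩ := hex
      rw [← hψe] at hu₀
      -- A superlevel set of `ψ` is exactly `{|u| > t}` with `ψ t = r`: convexity and `ψ 0 = 0` make
      -- `ψ` exceed `r` strictly beyond `t`.
      obtain ⟨t, ht, htr⟩ := intermediate_value_Icc (abs_nonneg u₀) hψc.continuousOn
        (show r ∈ Icc (ψ 0) (ψ |u₀|) from ⟨by rw [hψ0]; exact hr.le, hu₀.le⟩)
      have ht0 : 0 < t := ht.1.lt_of_ne fun h => by
        rw [← h, hψ0] at htr; exact hr.ne htr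
      have hset : {u | r < ψ u} = {u | t < |u|} := by
        ext u
        simp only [mem_ofPred_eq]
        rw [← hψe u]
        constructor
        · intro hu
          by_contra! hle
          exact absurd (hmono _ _ (abs_nonneg u) hle) (by rw [htr]; exact not_le.2 hu)
        · intro hu
          have hu0 : 0 < |u| := ht0.trans hu
          have h1 := hstar (t / |u|) |u| (by positivity) (by rw [div_le_one hu0]; exact hu.le)
          rw [div_mul_cancel₀ _ hu0.ne', htr] at h1
          by_contra! hle
          have h2 : t / |u| < 1 := by rw [div_lt_one hu0]; exact hu
          have h3 : t / |u| * ψ |u| ≤ t / |u| * r := by gcongr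
          nlinarith
      rw [hset]
      exact h t ht0.le
    · push Not at hex
      have : {u | r < ψ u} = ∅ := by
        ext u; simpa using hex u
      simp [this]
  have hνK : IsProbabilityMeasure (ν.map fun u => K * u) :=
    Measure.isProbabilityMeasure_map (by fun_prop)
  have hνKs : (ν.map fun u => K * u).map Neg.neg = ν.map fun u => K * u := by
    rw [Measure.map_map (by fun_prop) (by fun_prop)]
    conv_rhs => rw [← hν, Measure.map_map (by fun_prop) (by fun_prop)]
    congr 1
    funext u
    simp
  rw [hsymm μ inferInstance hμ, hsymm _ hνK hνKs]
  gcongr 1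
  rw [lintegral_map hψm (by fun_prop),
    lintegral_eq_lintegral_meas_lt μ (ae_of_all _ hψnn) hψc.aemeasurable]
  -- Layer-cake integration; the factor `K` in front then moves inside the argument because `K ψ(u)
  -- ≤ ψ(K u)`.
  calc _ ≤ ∫⁻ r in Ioi (0 : ℝ), ENNReal.ofReal K * ν {u | r < ψ u} :=
        setLIntegral_mono' measurableSet_Ioi fun r hr => htail r hr
    _ = ENNReal.ofReal K * ∫⁻ u, ENNReal.ofReal (ψ u) ∂ν := by
        rw [lintegral_const_mul' _ _ ENNReal.ofReal_ne_top,
          lintegral_eq_lintegral_meas_lt ν (ae_of_all _ hψnn) hψc.aemeasurable]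
    _ = ∫⁻ u, ENNReal.ofReal (K * ψ u) ∂ν := by
        rw [← lintegral_const_mul _ hψm]
        simp_rw [ENNReal.ofReal_mul (zero_le_one.trans hK)]
    _ ≤ _ := by
        refine lintegral_mono fun u => ENNReal.ofReal_le_ofReal ?_
        have hK0 : 0 < K := zero_lt_one.trans_le hK
        have := hstar K⁻¹ (K * u) (by positivity) (inv_le_one_of_one_le₀ hK)
        rw [inv_mul_cancel_left₀ hK0.ne'] at this
        calc K * ψ u ≤ K * (K⁻¹ * ψ (K * u)) := by gcongr
          _ = ψ (K * u) := by rw [mul_inv_cancel_left₀ hK0.ne']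

/-- Only the mass of `(u, u + 1]` is kept, where the density is bounded below using `(u + 1)² / 2 ≤
u² + 1`. -/
lemma exp_le_gaussianReal_Ioi {u : ℝ} (hu : 0 ≤ u) :
    ENNReal.ofReal ((√(2 * π))⁻¹ * exp (-1 - u ^ 2)) ≤ gaussianReal 0 1 (Ioi u) := by
  calc ENNReal.ofReal ((√(2 * π))⁻¹ * exp (-1 - u ^ 2))
      = ∫⁻ _ in Ioc u (u + 1), ENNReal.ofReal ((√(2 * π))⁻¹ * exp (-1 - u ^ 2)) := by simp
    _ ≤ ∫⁻ x in Ioc u (u + 1), gaussianPDF 0 1 x := by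
        refine setLIntegral_mono' measurableSet_Ioc fun x hx => ?_
        rw [gaussianPDF]
        refine ENNReal.ofReal_le_ofReal ?_
        simp only [gaussianPDFReal, NNReal.coe_one, mul_one, sub_zero]
        gcongr
        have : x ^ 2 ≤ (u + 1) ^ 2 := pow_le_pow_left₀ (hu.trans hx.1.le) hx.2 2
        nlinarith [sq_nonneg (u - 1)]
    _ = gaussianReal 0 1 (Ioc u (u + 1)) := (gaussianReal_apply _ one_ne_zero _).symm
    _ ≤ _ := measure_mono fun x hx => hx.1

variable {Ω : Type*} [MeasurableSpace Ω] {P : Measure Ω}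

lemma eLpNorm_le_of_subGaussianNorm {a : Ω → ℝ} (h : subGaussianNorm a P < ∞) {p : ℝ}
    (hp : 1 ≤ p) :
    eLpNorm a (ENNReal.ofReal p) P ≤ ENNReal.ofReal ((subGaussianNorm a P).toReal * √p) := by
  have hp0 : 0 < p := zero_lt_one.trans_le hp
  have h1 : ENNReal.ofReal (p ^ (-(1 / 2) : ℝ)) * eLpNorm a (ENNReal.ofReal p) P ≤
      subGaussianNorm a P :=
    le_iSup₂ (f := fun (p : ℝ) (_ : 1 ≤ p) =>
      ENNReal.ofReal (p ^ (-(1 / 2) : ℝ)) * eLpNorm a (ENNReal.ofReal p) P) p hp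
  rw [ENNReal.ofReal_mul ENNReal.toReal_nonneg, ENNReal.ofReal_toReal h.ne]
  calc _ = ENNReal.ofReal (p ^ (-(1 / 2) : ℝ)) * eLpNorm a (ENNReal.ofReal p) P *
        ENNReal.ofReal √p := by
        rw [mul_right_comm, ← ENNReal.ofReal_mul (by positivity), sqrt_eq_rpow, ← rpow_add hp0]
        simp
    _ ≤ _ := by gcongr

/-- Markov for the moment `p = (t / (e κ))²`: then `κ √p = t / e`, which gives `e^{-p}`. The extra
`1` in the exponent makes the bound trivial when `p ≤ 1`. -/
lemma measure_abs_gt_le_of_subGaussianNorm [IsProbabilityMeasure P] {a : Ω → ℝ} (ha : AEStronglyMeasurable a P)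
    (h : subGaussianNorm a P < ∞) {κ : ℝ} (hκ : κ = (subGaussianNorm a P).toReal) (hκ0 : 0 < κ)
    {t : ℝ} (ht : 0 ≤ t) :
    P {ω | t < |a ω|} ≤ ENNReal.ofReal (exp (1 - (t / (exp 1 * κ)) ^ 2)) := by
  rcases le_or_gt (t / (exp 1 * κ)) 1 with hle | hgt
  · refine prob_le_one.trans ?_
    rw [← ENNReal.ofReal_one]
    refine ENNReal.ofReal_le_ofReal (one_le_exp ?_)
    have : 0 ≤ t / (exp 1 * κ) := by positivity
    nlinarith
  set s := t / (exp 1 * κ) with hs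
  have ht0 : 0 < t := ht.lt_of_ne fun h0 => by rw [← h0, zero_div] at hs; linarith
  set p := s ^ 2 with hp
  have hp1 : 1 ≤ p := by nlinarith
  have hp0 : 0 < p := zero_lt_one.trans_le hp1
  have h1 := mul_meas_ge_le_pow_eLpNorm' P (p := ENNReal.ofReal p)
    (by simpa using hp0) ENNReal.ofReal_ne_top ha (ENNReal.ofReal t)
  rw [ENNReal.toReal_ofReal hp0.le] at h1
  have h2 := ENNReal.rpow_le_rpow (eLpNorm_le_of_subGaussianNorm h hp1) hp0.le
  rw [← hκ, ENNReal.ofReal_rpow_of_nonneg (by positivity) hp0.le] at h2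
  rw [ENNReal.ofReal_rpow_of_nonneg ht hp0.le] at h1
  have h3 : P {ω | t < |a ω|} ≤ P {x | ENNReal.ofReal t ≤ ‖a x‖ₑ} := by
    refine measure_mono fun ω hω => ?_
    simp only [mem_ofPred_eq] at hω ⊢
    rw [← ofReal_norm]
    exact ENNReal.ofReal_le_ofReal (by simpa using hω.le)
  have h4 : ENNReal.ofReal (t ^ p) * P {ω | t < |a ω|} ≤ ENNReal.ofReal ((κ * √p) ^ p) :=
    le_trans (by gcongr) (h1.trans h2)
  have htp : 0 < t ^ p := rpow_pos_of_pos ht0 p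
  rw [mul_comm, ← ENNReal.le_div_iff_mul_le (by simp [htp]) (by simp),
    ← ENNReal.ofReal_div_of_pos htp] at h4
  refine h4.trans (ENNReal.ofReal_le_ofReal ?_)
  have hs0 : 0 < s := by linarith
  have e1 : κ * √p = t * exp (-1) := by
    rw [hp, sqrt_sq hs0.le, hs, exp_neg]
    field_simp
  rw [e1, mul_rpow ht (exp_pos _).le, mul_div_cancel_left₀ _ htp.ne', ← exp_mul]
  gcongr
  linarith

/-- The left side is the ratio of the sub-gaussian upper tail bound to the Gaussian lower one,
whence the constant 20 in the domination. -/
lemma exp_two_mul_sqrt_le : exp 2 * √(2 * π) ≤ 20 := by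
  have h1 : exp 2 < 7.4 := by
    have := exp_one_lt_d9
    rw [show (2 : ℝ) = 1 + 1 by norm_num, exp_add]
    nlinarith [exp_pos 1]
  have h2 : √(2 * π) < 2.6 := by
    rw [sqrt_lt' (by norm_num)]
    have := pi_lt_d2
    norm_num at *
    linarith
  nlinarith [exp_pos 2, sqrt_nonneg (2 * π)]

/-- A symmetric sub-gaussian variable is dominated by a Gaussian variable in the convex order. -/
theorem convexDominated_gaussianReal [IsProbabilityMeasure P] {a : Ω → ℝ} (hsymm : IdentDistrib a (-a) P P)
    (h : subGaussianNorm a P < ∞) {κ : ℝ} (hκ : κ = (subGaussianNorm a P).toReal) (hκ0 : 0 < κ) :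
    ConvexDominated (P.map a) ((gaussianReal 0 1).map (fun u => 20 * (exp 1 * κ) * u)) := by
  have ham := hsymm.aemeasurable_fst
  have : IsProbabilityMeasure (P.map a) := Measure.isProbabilityMeasure_map ham
  set ν := (gaussianReal 0 1).map (fun u => exp 1 * κ * u) with hνdef
  have : IsProbabilityMeasure ν := Measure.isProbabilityMeasure_map (by fun_prop)
  have hc : 0 < exp 1 * κ := by positivity
  have hν : ν.map Neg.neg = ν := by
    rw [hνdef, gaussianReal_map_const_mul]
    have := gaussianReal_map_neg (μ := exp 1 * κ * 0) (v := .mk ((exp 1 * κ) ^ 2) (sq_nonneg _) * 1)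
    simpa using this
  have hμ : (P.map a).map Neg.neg = P.map a := by
    rw [AEMeasurable.map_map_of_aemeasurable measurable_neg.aemeasurable ham]
    exact hsymm.map_eq.symm
  have key := ConvexDominated.of_tail hμ hν (K := 20) (by norm_num) fun t ht => ?_
  · rw [hνdef, Measure.map_map (by fun_prop) (by fun_prop)] at key
    convert key using 2
    funext u
    simp [mul_assoc]
  · have hm : MeasurableSet {u : ℝ | t < |u|} := measurableSet_lt measurable_const (by fun_prop)
    rw [Measure.map_apply_of_aemeasurable ham hm, hνdef, Measure.map_apply (by fun_prop) hm]
    refine (measure_abs_gt_le_of_subGaussianNorm ham.aestronglyMeasurable h hκ hκ0 ht).trans ?_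
    have h1 := exp_le_gaussianReal_Ioi (show 0 ≤ t / (exp 1 * κ) by positivity)
    have h2 : gaussianReal 0 1 (Ioi (t / (exp 1 * κ))) ≤
        gaussianReal 0 1 ((fun u => exp 1 * κ * u) ⁻¹' {u | t < |u|}) := by
      refine measure_mono fun u hu => ?_
      simp only [mem_Ioi, mem_preimage, mem_ofPred_eq] at hu ⊢
      rw [div_lt_iff₀ hc] at hu
      exact lt_of_lt_of_le (by linarith) (le_abs_self _)
    calc _ ≤ ENNReal.ofReal (20 * ((√(2 * π))⁻¹ * exp (-1 - (t / (exp 1 * κ)) ^ 2))) := by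
          refine ENNReal.ofReal_le_ofReal ?_
          have e1 : exp (1 - (t / (exp 1 * κ)) ^ 2) =
              exp 2 * exp (-1 - (t / (exp 1 * κ)) ^ 2) := by
            rw [← exp_add]; congr 1; ring
          rw [e1, ← mul_assoc]
          gcongr
          rw [← div_eq_mul_inv, le_div_iff₀ (by positivity)]
          exact exp_two_mul_sqrt_le
      _ ≤ _ := by
          rw [ENNReal.ofReal_mul (by norm_num)]
          gcongr
          exact h1.trans h2

end ScalarConvexOrder

/-! ### Support functions of bounded sets. -/

section SupportFunction

open Filter Topology Set Real

variable {E : Type*} [NormedAddCommGroup E] [InnerProductSpace ℝ E]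

/-- The support function `u ↦ sup_{z ∈ T} ⟨u, z⟩`. -/
noncomputable def supportFunction (T : Set E) (u : E) : ℝ := sSup ((fun z => inner ℝ u z) '' T)

variable {T : Set E} {R : ℝ}

lemma bddAbove_image_inner (hT : ∀ z ∈ T, ‖z‖ ≤ R) (u : E) :
    BddAbove ((fun z => (inner ℝ u z : ℝ)) '' T) := by
  refine ⟨‖u‖ * R, ?_⟩
  rintro _ ⟨z, hz, rfl⟩
  exact (real_inner_le_norm u z).trans (by gcongr; exact hT z hz)

lemma inner_le_supportFunction (hT : ∀ z ∈ T, ‖z‖ ≤ R) (u : E) {z : E} (hz : z ∈ T) :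
    inner ℝ u z ≤ supportFunction T u :=
  le_csSup (bddAbove_image_inner hT u) ⟨z, hz, rfl⟩

lemma supportFunction_le (hne : T.Nonempty) {u : E} {b : ℝ} (h : ∀ z ∈ T, inner ℝ u z ≤ b) :
    supportFunction T u ≤ b := by
  refine csSup_le (hne.image _) ?_
  rintro _ ⟨z, hz, rfl⟩
  exact h z hz

lemma supportFunction_le_norm (hne : T.Nonempty) (hT : ∀ z ∈ T, ‖z‖ ≤ R) (u : E) :
    supportFunction T u ≤ R * ‖u‖ :=
  supportFunction_le hne fun z hz => (real_inner_le_norm u z).trans (by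
    rw [mul_comm]; gcongr; exact hT z hz)

lemma supportFunction_nonneg (hT : ∀ z ∈ T, ‖z‖ ≤ R) (h0 : (0 : E) ∈ T) (u : E) :
    0 ≤ supportFunction T u := by
  simpa using inner_le_supportFunction hT u h0

lemma exists_supportFunction_lt (hne : T.Nonempty) (u : E) {ε : ℝ} (hε : 0 < ε) :
    ∃ z ∈ T, supportFunction T u < inner ℝ u z + ε := by
  obtain ⟨_, ⟨z, hz, rfl⟩, h⟩ := exists_lt_of_lt_csSup (hne.image (fun z => (inner ℝ u z : ℝ)))
    (sub_lt_self (supportFunction T u) hε)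
  exact ⟨z, hz, by linarith⟩

lemma continuous_supportFunction (hne : T.Nonempty) (hT : ∀ z ∈ T, ‖z‖ ≤ R) :
    Continuous (supportFunction T) := by
  have hR : 0 ≤ R := (norm_nonneg _).trans (hT _ hne.some_mem)
  have key : ∀ u v, supportFunction T u ≤ supportFunction T v + R * ‖u - v‖ := fun u v => by
    refine supportFunction_le hne fun z hz => ?_
    have h1 := inner_le_supportFunction hT v hz
    have h2 : inner ℝ (u - v) z ≤ ‖u - v‖ * R :=
      (real_inner_le_norm _ z).trans (by gcongr; exact hT z hz)
    rw [inner_sub_left] at h2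
    linarith
  refine (LipschitzWith.of_le_add_mul R.toNNReal fun u v => ?_).continuous
  rw [Real.coe_toNNReal _ hR, dist_eq_norm]
  exact key u v

lemma convexOn_supportFunction (hne : T.Nonempty) (hT : ∀ z ∈ T, ‖z‖ ≤ R) :
    ConvexOn ℝ univ (supportFunction T) := by
  refine ⟨convex_univ, fun u _ v _ a b ha hb _ => supportFunction_le hne fun z hz => ?_⟩
  rw [inner_add_left, inner_smul_left, inner_smul_left, smul_eq_mul, smul_eq_mul]
  have h1 := inner_le_supportFunction hT u hz
  have h2 := inner_le_supportFunction hT v hz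
  simp only [conj_trivial]
  gcongr

lemma supportFunction_smul_eq (hne : T.Nonempty) (hT : ∀ z ∈ T, ‖z‖ ≤ R) {c : ℝ} (hc : 0 < c)
    (u : E) : supportFunction T (c • u) = c * supportFunction T u := by
  refine le_antisymm (supportFunction_le hne fun z hz => ?_) ?_
  · rw [real_inner_smul_left]
    gcongr
    exact inner_le_supportFunction hT u hz
  · rw [← le_div_iff₀' hc]
    refine supportFunction_le hne fun z hz => ?_
    rw [le_div_iff₀' hc, ← real_inner_smul_left]
    exact inner_le_supportFunction hT _ hz

end SupportFunction

/-! ### Exponential moments of Gaussian suprema. -/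

section GaussianConcentration

open Filter Topology Set Real

variable {E : Type*} [NormedAddCommGroup E] [InnerProductSpace ℝ E] [FiniteDimensional ℝ E]
  [MeasurableSpace E] [BorelSpace E] {T : Set E} {R : ℝ}

/-- Fernique's theorem makes `exp (C ‖u‖²)` integrable for some `C > 0`, and completing the square
absorbs `s R ‖u‖` into `C ‖u‖²`. -/
lemma integrable_exp_supportFunction (hne : T.Nonempty) (hT : ∀ z ∈ T, ‖z‖ ≤ R) {s : ℝ}
    (hs : 0 ≤ s) : Integrable (fun u => exp (s * supportFunction T u)) (stdGaussian E) := by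
  obtain ⟨C, hC, hi⟩ := IsGaussian.exists_integrable_exp_sq (stdGaussian E)
  have hcont := continuous_supportFunction hne hT
  refine (hi.const_mul (exp ((s * R) ^ 2 / (4 * C)))).mono' (by fun_prop)
    (ae_of_all _ fun u => ?_)
  rw [norm_eq_abs, abs_of_pos (exp_pos _), ← exp_add]
  gcongr
  have h1 := mul_le_mul_of_nonneg_left (supportFunction_le_norm hne hT u) hs
  have h2 : (s * R) ^ 2 / (4 * C) + C * ‖u‖ ^ 2 - s * R * ‖u‖ =
      (s * R - 2 * C * ‖u‖) ^ 2 / (4 * C) := by field_simp; ring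
  have h3 : 0 ≤ (s * R - 2 * C * ‖u‖) ^ 2 / (4 * C) := by positivity
  linarith

lemma integrable_supportFunction (hne : T.Nonempty) (hT : ∀ z ∈ T, ‖z‖ ≤ R)
    (h0 : (0 : E) ∈ T) : Integrable (supportFunction T) (stdGaussian E) := by
  have hcont := continuous_supportFunction hne hT
  refine (IsGaussian.integrable_id.norm.const_mul R).mono' (by fun_prop) (ae_of_all _ fun u => ?_)
  rw [norm_eq_abs, abs_of_nonneg (supportFunction_nonneg hT h0 u)]
  exact supportFunction_le_norm hne hT u

lemma lintegral_exp_inner_stdGaussian (z : E) (t : ℝ) :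
    ∫⁻ u, ENNReal.ofReal (exp (t * inner ℝ u z)) ∂(stdGaussian E) =
      ENNReal.ofReal (exp (t ^ 2 * ‖z‖ ^ 2 / 2)) := by
  have hlaw : (stdGaussian E).map (innerSL ℝ z) = gaussianReal 0 (‖z‖ ^ 2).toNNReal := by
    rw [IsGaussian.map_eq_gaussianReal, integral_strongDual_stdGaussian, variance_dual_stdGaussian]
    simp
  have hmgf := mgf_gaussianReal hlaw t
  have hi : Integrable (fun u => exp (t * innerSL ℝ z u)) (stdGaussian E) := by
    have := integrable_exp_mul_gaussianReal (μ := 0) (v := (‖z‖ ^ 2).toNNReal) t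
    rw [← hlaw, integrable_map_measure (by fun_prop) (by fun_prop)] at this
    exact this
  simp_rw [real_inner_comm z]
  rw [← ofReal_integral_eq_lintegral_ofReal (by simpa using hi) (ae_of_all _ fun u => (exp_pos _).le)]
  congr 1
  rw [mgf] at hmgf
  simp only [innerSL_apply_apply] at hmgf
  rw [hmgf, Real.coe_toNNReal _ (by positivity)]
  congr 1
  ring

/-- Testing the second support function at a near-maximizer `z` for `g` leaves `(2 - √2)` times the
support function at `g` and a term `-√2 ⟨g', z⟩`, linear in the Gaussian `g'`, whose exponential
moment is explicit. The gain is `2 - √2 < 1`. -/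
lemma lintegral_exp_supportFunction_sub_le (hne : T.Nonempty) (hT : ∀ z ∈ T, ‖z‖ ≤ R) {s : ℝ}
    (hs : 0 ≤ s) (g : E) :
    ∫⁻ g', ENNReal.ofReal (exp (2 * s * (supportFunction T g -
        supportFunction T ((√2)⁻¹ • g + (√2)⁻¹ • g')))) ∂(stdGaussian E)
      ≤ ENNReal.ofReal (exp (s * (2 - √2) * supportFunction T g + s ^ 2 * R ^ 2)) := by
  have hlim : Tendsto (fun ε : ℝ => ENNReal.ofReal (exp (2 * s * ε +
      (s * (2 - √2) * supportFunction T g + s ^ 2 * R ^ 2)))) (𝓝[>] 0)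
      (𝓝 (ENNReal.ofReal (exp (s * (2 - √2) * supportFunction T g + s ^ 2 * R ^ 2)))) := by
    have : Continuous fun ε : ℝ => ENNReal.ofReal (exp (2 * s * ε +
      (s * (2 - √2) * supportFunction T g + s ^ 2 * R ^ 2))) :=
      ENNReal.continuous_ofReal.comp (by fun_prop)
    have h := this.tendsto 0
    simp only [mul_zero, zero_add] at h
    exact h.mono_left nhdsWithin_le_nhds
  refine ge_of_tendsto hlim ?_
  filter_upwards [self_mem_nhdsWithin] with ε hε
  obtain ⟨z, hz, hlt⟩ := exists_supportFunction_lt hne g hε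
  have h2 : √2 * √2 = 2 := mul_self_sqrt (by norm_num)
  have hsq : 0 < √2 := by positivity
  have hinv : (√2)⁻¹ = √2 / 2 := by rw [inv_eq_iff_eq_inv, inv_div, eq_div_iff hsq.ne', h2]
  have hle1 : √2 ≤ 2 := by nlinarith
  calc _ ≤ ∫⁻ g', ENNReal.ofReal (exp (2 * s * ε + s * (2 - √2) * supportFunction T g)) *
        ENNReal.ofReal (exp (-(√2 * s) * inner ℝ g' z)) ∂(stdGaussian E) := by
        refine lintegral_mono fun g' => ?_
        rw [← ENNReal.ofReal_mul (exp_pos _).le, ← exp_add]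
        refine ENNReal.ofReal_le_ofReal (exp_le_exp.2 ?_)
        have h3 := inner_le_supportFunction hT ((√2)⁻¹ • g + (√2)⁻¹ • g') hz
        rw [inner_add_left, real_inner_smul_left, real_inner_smul_left, hinv] at h3
        have h4 := inner_le_supportFunction hT g hz
        have h5 : 2 * (supportFunction T g - supportFunction T ((√2)⁻¹ • g + (√2)⁻¹ • g')) ≤
            2 * ε + (2 - √2) * supportFunction T g - √2 * inner ℝ g' z := by
          rw [hinv]
          nlinarith
        nlinarith [mul_le_mul_of_nonneg_left h5 hs]
    _ = ENNReal.ofReal (exp (2 * s * ε + s * (2 - √2) * supportFunction T g + s ^ 2 * ‖z‖ ^ 2)) := by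
        rw [lintegral_const_mul' _ _ ENNReal.ofReal_ne_top, lintegral_exp_inner_stdGaussian,
          ← ENNReal.ofReal_mul (exp_pos _).le, ← exp_add]
        congr 3
        rw [neg_sq, mul_pow, sq_sqrt (by norm_num)]
        ring
    _ ≤ _ := by
        refine ENNReal.ofReal_le_ofReal (exp_le_exp.2 ?_)
        have : ‖z‖ ^ 2 ≤ R ^ 2 := pow_le_pow_left₀ (norm_nonneg _) (hT z hz) 2
        have h6 := mul_le_mul_of_nonneg_left this (sq_nonneg s)
        linarith

/-- Exponential moments of the supremum of a Gaussian process over a bounded set. -/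
theorem integral_exp_supportFunction_le (hT : ∀ z ∈ T, ‖z‖ ≤ R) (h0 : (0 : E) ∈ T) {s : ℝ}
    (hs : 0 ≤ s) :
    ∫ u, exp (s * supportFunction T u) ∂(stdGaussian E) ≤
      exp (3 * (s * ∫ u, supportFunction T u ∂(stdGaussian E) + s ^ 2 * R ^ 2)) := by
  have hne : T.Nonempty := ⟨0, h0⟩
  set γ := stdGaussian E with hγ
  set F := supportFunction T with hF
  set w := ∫ u, F u ∂γ with hw
  have hFc : Continuous F := continuous_supportFunction hne hT
  have hF0 : ∀ u, 0 ≤ F u := supportFunction_nonneg hT h0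
  have hFi : Integrable F γ := integrable_supportFunction hne hT h0
  have hMi : ∀ t, 0 ≤ t → Integrable (fun u => exp (t * F u)) γ := fun t ht =>
    integrable_exp_supportFunction hne hT ht
  have hw0 : 0 ≤ w := integral_nonneg hF0
  set M := ∫ u, exp (s * F u) ∂γ with hM
  have h2 : √2 * √2 = 2 := mul_self_sqrt (by norm_num)
  have hsq : 1.4 < √2 := by rw [lt_sqrt (by norm_num)]; norm_num
  have hsq' : √2 < 1.5 := by rw [sqrt_lt' (by norm_num)]; norm_num
  set c := 2 - √2 with hc
  have hM1 : 1 ≤ M := by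
    calc (1 : ℝ) = ∫ _, (1 : ℝ) ∂γ := by simp
      _ ≤ M := integral_mono (integrable_const _) (hMi s hs) fun u =>
          one_le_exp (mul_nonneg hs (hF0 u))
  -- Jensen for the concave power `c = 2 - √2`.
  have hMc : ∫ u, exp (s * c * F u) ∂γ ≤ M ^ c := by
    have hcc := (concaveOn_rpow (p := c) (by linarith) (by linarith)).le_map_integral
      (continuousOn_id.rpow_const (by intro x _; right; simp [hc])) isClosed_Ici
      (ae_of_all γ fun u => (exp_pos (s * F u)).le) (hMi s hs) (by
        have := hMi (s * c) (mul_nonneg hs (by linarith))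
        refine this.congr (ae_of_all _ fun u => ?_)
        simp only [Function.comp_apply, ← exp_mul]
        congr 1; ring)
    refine le_trans (le_of_eq ?_) hcc
    refine integral_congr_ae (ae_of_all _ fun u => ?_)
    simp only [← exp_mul]
    congr 1; ring
  -- A self-bounding inequality for `M`. Jensen turns the left side into at most `E exp(s (F(g) -
  -- F(g')))` for independent `g, g'`; then insert `F((g + g') / √2)` and use `ab ≤ (a² + b²) / 2`.
  have hstep : M * exp (-(s * w)) ≤ exp (s ^ 2 * R ^ 2) * M ^ c := by
    have hJ : exp (-(s * w)) ≤ ∫ u, exp (-(s * F u)) ∂γ := by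
      have hi : Integrable (fun u => exp (-(s * F u))) γ :=
        (integrable_const 1).mono' (by fun_prop) (ae_of_all _ fun u => by
          rw [norm_eq_abs, abs_of_pos (exp_pos _), exp_le_one_iff]
          exact neg_nonpos.2 (mul_nonneg hs (hF0 u)))
      have := convexOn_exp.map_integral_le (f := fun u => -(s * F u)) (μ := γ)
        continuous_exp.continuousOn isClosed_univ (by simp) (hFi.const_mul s).neg hi
      rwa [integral_neg, integral_const_mul] at this
    refine (mul_le_mul_of_nonneg_left hJ (by linarith)).trans ?_
    rw [hM, ← integral_prod_mul (fun u => exp (s * F u)) (fun u => exp (-(s * F u)))]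
    have hA : Measurable fun p : E × E => ENNReal.ofReal
        (exp (2 * s * (F p.1 - F ((√2)⁻¹ • p.1 + (√2)⁻¹ • p.2)))) := by
      have : Continuous fun p : E × E =>
        exp (2 * s * (F p.1 - F ((√2)⁻¹ • p.1 + (√2)⁻¹ • p.2))) := by fun_prop
      exact this.measurable.ennreal_ofReal
    have hAle : ∫⁻ p, ENNReal.ofReal (exp (2 * s * (F p.1 - F ((√2)⁻¹ • p.1 + (√2)⁻¹ • p.2))))
        ∂(γ.prod γ) ≤ ENNReal.ofReal (exp (s ^ 2 * R ^ 2) * M ^ c) := by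
      rw [lintegral_prod _ hA.aemeasurable]
      refine (lintegral_mono fun g => lintegral_exp_supportFunction_sub_le hne hT hs g).trans ?_
      have hi := (hMi (s * c) (mul_nonneg hs (by linarith))).const_mul (exp (s ^ 2 * R ^ 2))
      have e : ∀ g, exp (s * (2 - √2) * supportFunction T g + s ^ 2 * R ^ 2) =
          exp (s ^ 2 * R ^ 2) * exp (s * c * F g) := fun g => by rw [← exp_add, add_comm]
      simp_rw [e]
      rw [← ofReal_integral_eq_lintegral_ofReal hi (ae_of_all _ fun u => by positivity),
        integral_const_mul]
      exact ENNReal.ofReal_le_ofReal (by gcongr)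
    -- Rotation by `π/4` preserves the law of the pair and carries the first half of the inserted
    -- difference to the second, so one bound serves both.
    have hrot : (γ.prod γ).map (ContinuousLinearMap.rotation (π / 4)) = γ.prod γ :=
      IsGaussian.map_rotation_eq_self (by simp [hγ]) _
    have hBle : ∫⁻ p, ENNReal.ofReal (exp (2 * s * (F ((√2)⁻¹ • p.1 + (√2)⁻¹ • p.2) - F p.2)))
        ∂(γ.prod γ) ≤ ENNReal.ofReal (exp (s ^ 2 * R ^ 2) * M ^ c) := by
      rw [← hrot, lintegral_map hA (by fun_prop)] at hAle
      refine le_trans (le_of_eq ?_) hAle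
      refine lintegral_congr fun p => ?_
      have hcos : cos (π / 4) = (√2)⁻¹ := by
        rw [cos_pi_div_four, eq_comm, inv_eq_iff_eq_inv, inv_div, eq_div_iff (by positivity), h2]
      have hsin : sin (π / 4) = (√2)⁻¹ := by
        rw [sin_pi_div_four, eq_comm, inv_eq_iff_eq_inv, inv_div, eq_div_iff (by positivity), h2]
      have hhalf : (√2)⁻¹ * (√2)⁻¹ = 2⁻¹ := by rw [← mul_inv, h2]
      simp only [ContinuousLinearMap.rotation_apply, hcos, hsin]
      congr 6
      simp only [smul_add, smul_smul, neg_smul, smul_neg, hhalf]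
      have : p.2 = (2⁻¹ + 2⁻¹ : ℝ) • p.2 := by norm_num
      conv_lhs => rw [this, add_smul]
      abel
    have hprod : ∫ z, exp (s * F z.1) * exp (-(s * F z.2)) ∂(γ.prod γ) =
        (∫⁻ z, ENNReal.ofReal (exp (s * F z.1) * exp (-(s * F z.2))) ∂(γ.prod γ)).toReal :=
      integral_eq_lintegral_of_nonneg_ae (ae_of_all _ fun z => by positivity)
        (Continuous.aestronglyMeasurable (by fun_prop))
    rw [hprod]
    refine ENNReal.toReal_le_of_le_ofReal (by positivity) ?_
    calc _ ≤ ∫⁻ p, 2⁻¹ * (ENNReal.ofReal (exp (2 * s * (F p.1 -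
            F ((√2)⁻¹ • p.1 + (√2)⁻¹ • p.2)))) + ENNReal.ofReal (exp (2 * s *
            (F ((√2)⁻¹ • p.1 + (√2)⁻¹ • p.2) - F p.2)))) ∂(γ.prod γ) := by
          refine lintegral_mono fun p => ?_
          rw [← ENNReal.ofReal_add (exp_pos _).le (exp_pos _).le,
            show (2 : ℝ≥0∞)⁻¹ = ENNReal.ofReal 2⁻¹ by
              rw [ENNReal.ofReal_inv_of_pos two_pos]; simp,
            ← ENNReal.ofReal_mul (by norm_num)]
          refine ENNReal.ofReal_le_ofReal ?_
          rw [← exp_add]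
          set a := F ((√2)⁻¹ • p.1 + (√2)⁻¹ • p.2)
          have e1 : s * F p.1 + -(s * F p.2) = s * (F p.1 - a) + s * (a - F p.2) := by ring
          have e2 : ∀ b : ℝ, exp (2 * s * b) = exp (s * b) ^ 2 := fun b => by
            rw [← exp_nat_mul]; congr 1; push_cast; ring
          rw [e1, exp_add, e2, e2]
          nlinarith [sq_nonneg (exp (s * (F p.1 - a)) - exp (s * (a - F p.2)))]
      _ ≤ 2⁻¹ * (ENNReal.ofReal (exp (s ^ 2 * R ^ 2) * M ^ c) +
            ENNReal.ofReal (exp (s ^ 2 * R ^ 2) * M ^ c)) := by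
          rw [lintegral_const_mul' _ _ (by simp), lintegral_add_left hA]
          gcongr
      _ = _ := by
          rw [← two_mul, ← mul_assoc, ENNReal.inv_mul_cancel (by simp) (by simp), one_mul]
  have hMpos : 0 < M := by linarith
  -- Taking logarithms, `(√2 - 1) log M ≤ s w + s² R²`, and `1 / (√2 - 1) ≤ 3`.
  have hlog := log_le_log (by positivity) hstep
  rw [log_mul hMpos.ne' (exp_pos _).ne', log_mul (exp_pos _).ne' (rpow_pos_of_pos hMpos c).ne',
    log_exp, log_exp, log_rpow hMpos] at hlog
  rw [← log_le_iff_le_exp hMpos]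
  have hl0 : 0 ≤ log M := log_nonneg hM1
  have hR2 : 0 ≤ s ^ 2 * R ^ 2 := by positivity
  have hsw : 0 ≤ s * w := mul_nonneg hs hw0
  nlinarith

end GaussianConcentration

/-! ### Gaussian domination of vectors and of their sums. -/

section GaussianDomination

open Filter Topology Set Real

variable {Ω : Type*} [MeasurableSpace Ω] {P : Measure Ω} [IsProbabilityMeasure P] {n : ℕ}

/-- The vector is a sum of independent vectors along the coordinate axes, so scalar domination adds
up. -/
lemma ConvexDominated.of_coords {V : Ω → EuclideanSpace ℝ (Fin n)} (hV : Measurable V)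
    (hind : iIndepFun (fun j ω => V ω j) P) {L : ℝ}
    (h : ∀ j, ConvexDominated (P.map fun ω => V ω j) ((gaussianReal 0 1).map fun u => L * u)) :
    ConvexDominated (P.map V) ((stdGaussian (EuclideanSpace ℝ (Fin n))).map fun u => L • u) := by
  set T : Fin n → ℝ →L[ℝ] EuclideanSpace ℝ (Fin n) := fun j =>
    ContinuousLinearMap.toSpanSingleton ℝ (EuclideanSpace.single j (1 : ℝ)) with hT
  set Q : Measure (Fin n → ℝ) := Measure.pi fun _ => gaussianReal 0 1 with hQ
  have hY : iIndepFun (fun (j : Fin n) (g : Fin n → ℝ) => T j (L * g j)) Q :=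
    (iIndepFun_pi (X := fun (j : Fin n) (t : ℝ) => T j (L * t))
      (fun j => by fun_prop))
  have hX : iIndepFun (fun (j : Fin n) ω => T j (V ω j)) P :=
    hind.comp (fun j t => T j t) fun j => by fun_prop
  have key := ConvexDominated.sum hX hY (fun j => by fun_prop) (fun j => by fun_prop)
    (fun j => ?_) Finset.univ
  · have hsum : ∀ v : Fin n → ℝ, ∑ j, T j (v j) = WithLp.toLp 2 v := fun v => by
      ext k
      simp [hT, Finset.sum_apply, Pi.single_apply]
    have e1 : (∑ j, fun ω => T j (V ω j)) = V := by
      funext ω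
      rw [Finset.sum_apply, hsum]
    have e2 : (∑ j, fun g : Fin n → ℝ => T j (L * g j)) =
        (fun u : EuclideanSpace ℝ (Fin n) => L • u) ∘ WithLp.toLp 2 := by
      funext g
      rw [Finset.sum_apply, hsum fun j => L * g j]
      ext k
      simp
    rw [e1, e2, ← Measure.map_map (by fun_prop) (by fun_prop), map_pi_eq_stdGaussian] at key
    exact key
  · have h1 := (h j).map (T j)
    have hev : Q.map (fun g => g j) = gaussianReal 0 1 :=
      (measurePreserving_eval (fun _ : Fin n => gaussianReal 0 1) j).map_eq
    rw [Measure.map_map (by fun_prop) (by fun_prop), ← hev,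
      Measure.map_map (by fun_prop) (by fun_prop), Measure.map_map (by fun_prop) (by fun_prop)]
      at h1
    exact h1

lemma ConvexDominated.sum_stdGaussian {m : ℕ} {X : Fin m → Ω → EuclideanSpace ℝ (Fin n)}
    (hX : iIndepFun X P) (hXm : ∀ i, Measurable (X i)) {c : ℝ}
    (h : ∀ i, ConvexDominated (P.map (X i))
      ((stdGaussian (EuclideanSpace ℝ (Fin n))).map fun u => c • u)) :
    ConvexDominated (P.map (∑ i, X i))
      ((stdGaussian (EuclideanSpace ℝ (Fin n))).map fun u => (√m * c) • u) := by
  set γ := stdGaussian (EuclideanSpace ℝ (Fin n))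
  set Q : Measure (Fin m → EuclideanSpace ℝ (Fin n)) := Measure.pi fun _ => γ
  set Y : Fin m → (Fin m → EuclideanSpace ℝ (Fin n)) → EuclideanSpace ℝ (Fin n) :=
    fun i g => c • g i with hYdef
  have hYm : ∀ i, Measurable (Y i) := fun i => by fun_prop
  have hY : iIndepFun Y Q :=
    iIndepFun_pi (X := fun (_ : Fin m) (u : EuclideanSpace ℝ (Fin n)) => c • u)
      (fun j => by fun_prop)
  have hlaw : ∀ i, Q.map (Y i) = γ.map fun u => c • u := fun i => by
    have hev : Q.map (fun g => g i) = γ := (measurePreserving_eval (fun _ : Fin m => γ) i).map_eq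
    conv_rhs => rw [← hev, Measure.map_map (by fun_prop) (by fun_prop)]
    rfl
  have key := ConvexDominated.sum hX hY hXm hYm (fun i => by rw [hlaw]; exact h i) Finset.univ
  convert key using 1
  have hp : IsProbabilityMeasure (Q.map (∑ i, Y i)) := Measure.isProbabilityMeasure_map (by
    rw [Finset.sum_fn]
    exact (Finset.measurable_sum _ fun i _ => hYm i).aemeasurable)
  have hp2 : IsProbabilityMeasure (γ.map fun u => (√m * c) • u) :=
    Measure.isProbabilityMeasure_map (by fun_prop)
  -- The sum of `m` independent Gaussian vectors is identified with `√m` times one of them by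
  -- characteristic functions.
  refine Measure.ext_of_charFun (funext fun t => ?_)
  rw [hY.charFun_map_sum_eq_prod fun i => (hYm i).aemeasurable, Finset.prod_apply]
  simp_rw [hlaw, charFun_map_smul, γ, charFun_stdGaussian, norm_smul]
  rw [Finset.prod_const, ← Complex.exp_nat_mul]
  congr 1
  have : ((√(m : ℝ) : ℝ) : ℂ) ^ 2 = m := by
    rw [← Complex.ofReal_pow, sq_sqrt (by positivity), Complex.ofReal_natCast]
  simp only [norm_mul, norm_eq_abs, abs_of_nonneg (sqrt_nonneg _), Complex.ofReal_mul, mul_pow,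
    this, Finset.card_univ, Fintype.card_fin]
  ring

end GaussianDomination

/-! ### Independence of pairs from rectangles. -/

section Independence

open Set

/-- To check the independence of a family of pairs it is enough to consider rectangles. -/
lemma iIndepFun_prodMk_of_rectangles {Ω ι α β : Type*} [mΩ : MeasurableSpace Ω]
    {P : Measure Ω} [IsProbabilityMeasure P] [MeasurableSpace α] [MeasurableSpace β] {f : ι → Ω → α}
    {g : ι → Ω → β} (hf : ∀ i, Measurable (f i)) (hg : ∀ i, Measurable (g i))
    (h : ∀ (s : Finset ι) (D : ι → Set α) (B : ι → Set β), (∀ i, MeasurableSet (D i)) →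
      (∀ i, MeasurableSet (B i)) → P.real (⋂ i ∈ s, (f i ⁻¹' D i ∩ g i ⁻¹' B i)) =
        ∏ i ∈ s, P.real (f i ⁻¹' D i ∩ g i ⁻¹' B i)) :
    iIndepFun (fun i ω => (f i ω, g i ω)) P := by
  rw [iIndepFun_iff_iIndep]
  refine iIndepSets.iIndep (fun i => ((hf i).prodMk (hg i)).comap_le)
    (fun i => preimage (fun ω => (f i ω, g i ω)) ''
      (image2 (· ×ˢ ·) {s : Set α | MeasurableSet s} {t : Set β | MeasurableSet t}))
    (fun i => ?_) (fun i => ?_) ?_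
  · rintro _ ⟨s, hs, rfl⟩ _ ⟨t, ht, rfl⟩ hne
    refine ⟨s ∩ t, isPiSystem_prod s hs t ht ?_, preimage_inter⟩
    obtain ⟨ω, h1, h2⟩ := hne
    exact ⟨_, h1, h2⟩
  · rw [← MeasurableSpace.comap_generateFrom, generateFrom_prod]
  · rw [iIndepSets_iff]
    intro s F hF
    have hF' : ∀ i, ∃ (D : Set α) (B : Set β), MeasurableSet D ∧ MeasurableSet B ∧
        (i ∈ s → F i = f i ⁻¹' D ∩ g i ⁻¹' B) := fun i => by
      by_cases hi : i ∈ s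
      · obtain ⟨_, ⟨D, hD, B, hB, rfl⟩, hFi⟩ := hF i hi
        exact ⟨D, B, hD, hB, fun _ => by rw [← hFi]; rfl⟩
      · exact ⟨univ, univ, .univ, .univ, fun h => absurd h hi⟩
    choose D B hD hB hDB using hF'
    have h1 : ⋂ i ∈ s, F i = ⋂ i ∈ s, (f i ⁻¹' D i ∩ g i ⁻¹' B i) :=
      iInter₂_congr fun i hi => hDB i hi
    have h2 := h s D B hD hB
    rw [h1, Finset.prod_congr rfl fun i hi => by rw [hDB i hi]]
    rw [← ENNReal.toReal_eq_toReal_iff' (measure_ne_top _ _)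
      (ENNReal.prod_ne_top fun i _ => measure_ne_top _ _), ENNReal.toReal_prod]
    exact h2

end Independence

/-! ### The generalized linear model: joint independence and conditional means. -/

section Model

open Filter Topology Set Real

lemma measurable_sigmaGenerated {Ω : Type*} {m n : ℕ}
    {A : Fin m → Ω → EuclideanSpace ℝ (Fin n)} (i : Fin m) : Measurable[sigmaGenerated A] (A i) := by
  have h : Measurable[sigmaGenerated A] (fun ω i => A i ω) := comap_measurable _
  exact (measurable_pi_apply i).comp h

variable {Ω : Type*} [MeasurableSpace Ω] {P : Measure Ω} [IsProbabilityMeasure P] {m n : ℕ}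
  {A : Fin m → Ω → EuclideanSpace ℝ (Fin n)} {y : Fin m → Ω → ℝ}
  {x : EuclideanSpace ℝ (Fin n)} {θ : ℝ → ℝ}

lemma sigmaGenerated_le (hA : ∀ i, Measurable (A i)) : sigmaGenerated A ≤ ‹MeasurableSpace Ω› :=
  (measurable_pi_lambda _ hA).comap_le

namespace GeneralizedLinearModel

lemma integrable (hy : GeneralizedLinearModel P A y x θ) (i : Fin m) : Integrable (y i) P :=
  (integrable_const (1 : ℝ)).mono' (hy.measurable i).aestronglyMeasurable
    (ae_of_all _ fun ω => by rcases hy.sign_valued i ω with h | h <;> simp [h])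

/-- Every function of a sign is affine in it, so conditional probabilities are affine in the
conditional mean. In particular they depend on `A i` alone. -/
lemma condProb_eq (hy : GeneralizedLinearModel P A y x θ) (hA : ∀ i, Measurable (A i))
    (D : Set ℝ) : ∃ α β : ℝ, ∀ i, P⟦y i ⁻¹' D | sigmaGenerated A⟧ =ᵐ[P]
      fun ω => α + β * θ (inner ℝ (A i ω) x) := by
  set d : ℝ → ℝ := D.indicator fun _ => 1
  refine ⟨(d 1 + d (-1)) / 2, (d 1 - d (-1)) / 2, fun i => ?_⟩
  have e : (y i ⁻¹' D).indicator (fun _ => (1 : ℝ)) =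
      (fun _ => (d 1 + d (-1)) / 2) + ((d 1 - d (-1)) / 2) • y i := by
    funext ω
    have : (y i ⁻¹' D).indicator (fun _ => (1 : ℝ)) ω = d (y i ω) := rfl
    rw [this]
    rcases hy.sign_valued i ω with h | h <;> simp [h] <;> ring
  rw [e]
  have h1 := condExp_add (integrable_const (μ := P) ((d 1 + d (-1)) / 2))
    ((hy.integrable i).smul ((d 1 - d (-1)) / 2)) (sigmaGenerated A)
  have h2 := condExp_smul (μ := P) ((d 1 - d (-1)) / 2) (y i) (sigmaGenerated A)
  rw [condExp_const (sigmaGenerated_le hA)] at h1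
  filter_upwards [h1, h2, hy.condExp_eq i] with ω h1 h2 h3
  rw [h1, Pi.add_apply, h2, Pi.smul_apply, h3, smul_eq_mul]

/-- By conditional independence the probability of a rectangle is the integral of a product of
functions of the single `A i`, and independence of the `A i` factorizes it. -/
lemma iIndepFun_prodMk (hy : GeneralizedLinearModel P A y x θ) (hA : ∀ i, Measurable (A i))
    (hind : iIndepFun A P) (hθ : Measurable θ) :
    iIndepFun (fun i ω => (y i ω, A i ω)) P := by
  classical
  refine iIndepFun_prodMk_of_rectangles hy.measurable hA fun s D B hD hB => ?_
  choose α β hαβ using fun i => hy.condProb_eq hA (D i)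
  set q : Fin m → EuclideanSpace ℝ (Fin n) → ℝ := fun i u => α i + β i * θ (inner ℝ u x)
  have hq : ∀ i, Measurable (q i) := fun i => by fun_prop
  set h : Fin m → EuclideanSpace ℝ (Fin n) → ℝ := fun i => (B i).indicator (q i)
  have hh : ∀ i, Measurable (h i) := fun i => (hq i).indicator (hB i)
  have key : ∀ t : Finset (Fin m), P.real (⋂ i ∈ t, (y i ⁻¹' D i ∩ A i ⁻¹' B i)) =
      ∫ ω, ∏ i ∈ t, h i (A i ω) ∂P := by
    intro t
    set Ey := ⋂ i ∈ t, y i ⁻¹' D i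
    set EA := ⋂ i ∈ t, A i ⁻¹' B i
    have hEy : MeasurableSet Ey := Finset.measurableSet_biInter _ fun i _ => hy.measurable i (hD i)
    have hEA : MeasurableSet[sigmaGenerated A] EA :=
      Finset.measurableSet_biInter _ fun i _ => measurable_sigmaGenerated i (hB i)
    have hEA' : MeasurableSet EA := sigmaGenerated_le hA _ hEA
    have e1 : (⋂ i ∈ t, (y i ⁻¹' D i ∩ A i ⁻¹' B i)) = EA ∩ Ey := by
      ext ω; simp [EA, Ey, forall_and, and_comm]
    have hprod : P⟦Ey | sigmaGenerated A⟧ =ᵐ[P] fun ω => ∏ i ∈ t, q i (A i ω) := by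
      refine (hy.condIndep t D fun i _ => hD i).trans ?_
      filter_upwards [eventually_countable_forall.2 fun i => hαβ i i] with ω hω
      rw [Finset.prod_apply]
      exact Finset.prod_congr rfl fun i _ => hω i
    have e2 := setIntegral_condExp (sigmaGenerated_le hA) (μ := P)
      ((integrable_const (1 : ℝ)).indicator hEy) hEA
    rw [setIntegral_congr_ae hEA' (hprod.mono fun ω h _ => h)] at e2
    rw [integral_indicator_const _ hEy, smul_eq_mul, mul_one, measureReal_restrict_apply hEy,
      inter_comm, ← e1, ← integral_indicator hEA'] at e2
    rw [← e2]
    refine integral_congr_ae (ae_of_all _ fun ω => ?_)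
    by_cases hω : ω ∈ EA
    · simp only [indicator_of_mem hω]
      refine Finset.prod_congr rfl fun i hi => ?_
      have : A i ω ∈ B i := by simpa using mem_iInter₂.1 hω i hi
      simp [h, this]
    · simp only [indicator_of_notMem hω]
      simp only [EA, mem_iInter, not_forall] at hω
      obtain ⟨i, hi, hω⟩ := hω
      exact (Finset.prod_eq_zero hi (indicator_of_notMem (show A i ω ∉ B i from hω) _)).symm
  have hsingle : ∀ i, P.real (y i ⁻¹' D i ∩ A i ⁻¹' B i) = ∫ ω, h i (A i ω) ∂P := fun i => by
    simpa using key {i}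
  rw [key s, Finset.prod_congr rfl fun i _ => hsingle i]
  -- Padding with the constant 1 extends the product over `s` to all indices.
  set h' : Fin m → EuclideanSpace ℝ (Fin n) → ℝ := fun i => if i ∈ s then h i else fun _ => 1
  have e3 := hind.integral_fun_prod_comp (f := h') (fun i => (hA i).aemeasurable) fun i => by
    have : Measurable (h' i) := by
      simp only [h']
      split_ifs
      · exact hh i
      · fun_prop
    exact this.aestronglyMeasurable
  have e4 : ∀ ω, ∏ i, h' i (A i ω) = ∏ i ∈ s, h i (A i ω) := fun ω => by
    rw [← Finset.prod_subset (Finset.subset_univ s) fun i _ hi => by simp [h', hi]]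
    exact Finset.prod_congr rfl fun i hi => by simp [h', hi]
  have e5 : ∏ i, ∫ ω, h' i (A i ω) ∂P = ∏ i ∈ s, ∫ ω, h i (A i ω) ∂P := by
    rw [← Finset.prod_subset (Finset.subset_univ s) fun i _ hi => by simp [h', hi]]
    exact Finset.prod_congr rfl fun i hi => by simp [h', hi]
  simp_rw [e4, e5] at e3
  exact e3

lemma iIndepFun_smul (hy : GeneralizedLinearModel P A y x θ) (hA : ∀ i, Measurable (A i))
    (hind : iIndepFun A P) (hθ : Measurable θ) :
    iIndepFun (fun i ω => y i ω • A i ω) P :=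
  (hy.iIndepFun_prodMk hA hind hθ).comp (fun _ p => p.1 • p.2) fun _ => by fun_prop

lemma integral_mul_inner (hy : GeneralizedLinearModel P A y x θ) (hA : ∀ i, Measurable (A i))
    (i : Fin m) {z : EuclideanSpace ℝ (Fin n)} (hz : Integrable (fun ω => (inner ℝ (A i ω) z : ℝ)) P) :
    ∫ ω, y i ω * inner ℝ (A i ω) z ∂P = ∫ ω, θ (inner ℝ (A i ω) x) * inner ℝ (A i ω) z ∂P := by
  have hm : StronglyMeasurable[sigmaGenerated A] fun ω => (inner ℝ (A i ω) z : ℝ) := by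
    have h1 : Measurable fun u : EuclideanSpace ℝ (Fin n) => (inner ℝ u z : ℝ) := by fun_prop
    exact (h1.comp (measurable_sigmaGenerated i)).stronglyMeasurable
  have hyi : Integrable (y i * fun ω => (inner ℝ (A i ω) z : ℝ)) P := by
    refine hz.bdd_mul (c := 1) (hy.measurable i).aestronglyMeasurable (ae_of_all _ fun ω => ?_)
    rcases hy.sign_valued i ω with h | h <;> simp [h]
  have h1 := condExp_mul_of_stronglyMeasurable_right hm hyi (hy.integrable i)
  change ∫ ω, (y i * fun ω => (inner ℝ (A i ω) z : ℝ)) ω ∂P = _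
  rw [← integral_condExp (sigmaGenerated_le hA)]
  refine integral_congr_ae ?_
  filter_upwards [h1, hy.condExp_eq i] with ω h1 h2
  rw [h1, Pi.mul_apply, h2]

end GeneralizedLinearModel

end Model

/-! ### Moments from the sub-gaussian norm. -/

section Moments

open Filter Topology Set Real

variable {Ω : Type*} [MeasurableSpace Ω] {P : Measure Ω} {a : Ω → ℝ}

lemma memLp_of_subGaussianNorm (ha : AEStronglyMeasurable a P) (h : subGaussianNorm a P < ∞)
    {p : ℝ} (hp : 1 ≤ p) : MemLp a (ENNReal.ofReal p) P :=
  ⟨ha, (eLpNorm_le_of_subGaussianNorm h hp).trans_lt ENNReal.ofReal_lt_top⟩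

lemma integral_abs_pow_le_of_subGaussianNorm (ha : AEStronglyMeasurable a P)
    (h : subGaussianNorm a P < ∞) {k : ℕ} (hk : 1 ≤ k) :
    ∫ ω, |a ω| ^ k ∂P ≤ ((subGaussianNorm a P).toReal * √k) ^ k := by
  have hk' : (1 : ℝ) ≤ k := by exact_mod_cast hk
  have hmem := memLp_of_subGaussianNorm ha h hk'
  have hle := eLpNorm_le_of_subGaussianNorm h hk'
  rw [hmem.eLpNorm_eq_integral_rpow_norm (by simp; omega) ENNReal.ofReal_ne_top,
    ENNReal.ofReal_le_ofReal_iff (by positivity), ENNReal.toReal_ofReal (by positivity)] at hle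
  simp only [norm_eq_abs, rpow_natCast] at hle
  have hI : 0 ≤ ∫ ω, |a ω| ^ k ∂P := integral_nonneg fun ω => by positivity
  calc ∫ ω, |a ω| ^ k ∂P = ((∫ ω, |a ω| ^ k ∂P) ^ (k : ℝ)⁻¹) ^ k := by
        rw [rpow_inv_natCast_pow hI (by omega)]
    _ ≤ _ := by gcongr

lemma integral_eq_zero_of_symmetric (h : IdentDistrib a (-a) P P) : ∫ ω, a ω ∂P = 0 := by
  have := h.integral_eq
  simp only [Pi.neg_apply, integral_neg] at this
  linarith

lemma integral_sq_of_symmetric (h : IdentDistrib a (-a) P P) (hv : Var[a; P] = 1) :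
    ∫ ω, a ω ^ 2 ∂P = 1 := by
  rw [variance_eq_integral h.aemeasurable_fst, integral_eq_zero_of_symmetric h] at hv
  simpa using hv

/-- The case `p = 2` of the norm. This lower bound on `κ` lets `κ ^ 4` absorb lower powers and
constants. -/
lemma one_le_two_mul_sq_subGaussianNorm (hs : IdentDistrib a (-a) P P) (hv : Var[a; P] = 1)
    (h : subGaussianNorm a P < ∞) : 1 ≤ 2 * (subGaussianNorm a P).toReal ^ 2 := by
  have h1 := integral_abs_pow_le_of_subGaussianNorm hs.aemeasurable_fst.aestronglyMeasurable h
    (k := 2) (by norm_num)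
  simp only [sq_abs, integral_sq_of_symmetric hs hv] at h1
  rw [mul_pow, sq_sqrt (by positivity)] at h1
  push_cast at h1
  linarith

lemma hasStandardCoords_of_identDistrib [IsProbabilityMeasure P] {Ω' : Type*} [MeasurableSpace Ω']
    {P' : Measure Ω'} [IsProbabilityMeasure P'] {n : ℕ} {X : Ω' → EuclideanSpace ℝ (Fin n)}
    (hX : Measurable X) (hind : iIndepFun (fun j ω => X ω j) P')
    (hid : ∀ j, IdentDistrib (fun ω => X ω j) a P' P) (hs : IdentDistrib a (-a) P P)
    (hv : Var[a; P] = 1) (h : subGaussianNorm a P < ∞) :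
    HasStandardCoords X P' (((subGaussianNorm a P).toReal * √3) ^ 3) where
  measurable := hX
  indep := hind
  memLp j := by
    have := memLp_of_subGaussianNorm hs.aemeasurable_fst.aestronglyMeasurable h
      (p := 3) (by norm_num)
    rw [(hid j).memLp_iff]
    simpa using this
  mean j := by rw [(hid j).integral_eq, integral_eq_zero_of_symmetric hs]
  var j := by
    rw [← integral_sq_of_symmetric hs hv]
    exact ((hid j).comp (u := fun t : ℝ => t ^ 2) (by fun_prop)).integral_eq
  third j := by
    have h1 := integral_abs_pow_le_of_subGaussianNorm hs.aemeasurable_fst.aestronglyMeasurable h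
      (k := 3) (by norm_num)
    refine le_trans (le_of_eq ?_) (by exact_mod_cast h1)
    exact ((hid j).comp (u := fun t : ℝ => |t| ^ 3) (by fun_prop)).integral_eq

end Moments

/-! ### Tail bound from convex domination. -/

section Deviation

open Filter Topology Set Real

variable {Ω : Type*} [MeasurableSpace Ω] {P : Measure Ω}

/-- Tail bound for the supremum of a linear process dominated by a Gaussian process. -/
theorem ConvexDominated.measure_supportFunction_ge_le {E : Type*} [NormedAddCommGroup E]
    [InnerProductSpace ℝ E] [FiniteDimensional ℝ E] [MeasurableSpace E] [BorelSpace E]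
    {T : Set E} (hT : ∀ z ∈ T, ‖z‖ ≤ 2) (h0 : (0 : E) ∈ T) {W : Ω → E} (hW : Measurable W)
    {σ : ℝ} (hσ : 0 < σ)
    (h : ConvexDominated (P.map W) ((stdGaussian E).map fun u => σ • u)) {β : ℝ} (hβ : 0 < β) :
    P {ω | σ * (3 * ∫ u, supportFunction T u ∂(stdGaussian E) + 7 * β) ≤ supportFunction T (W ω)}
      ≤ ENNReal.ofReal (exp (-β ^ 2)) := by
  have hne : T.Nonempty := ⟨0, h0⟩
  set w := ∫ u, supportFunction T u ∂(stdGaussian E) with hw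
  -- Nearly optimal in Markov's inequality: the exponent becomes `12 v² - 7 β v = -(50/49) β²`.
  set v := 2 * β / 7 with hv
  have hv0 : 0 ≤ v := by positivity
  set s := v / σ with hs
  have hs0 : 0 ≤ s := by positivity
  have hFc : Continuous (supportFunction T) := continuous_supportFunction hne hT
  have hconv : ConvexOn ℝ univ fun u => exp (s * supportFunction T u) := by
    have h1 := (convexOn_supportFunction hne hT).smul hs0
    refine ⟨convex_univ, fun u hu u' hu' a b ha hb hab => ?_⟩
    exact (exp_le_exp.2 (h1.2 hu hu' ha hb hab)).trans
      (convexOn_exp.2 (mem_univ _) (mem_univ _) ha hb hab)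
  have h1 := h (fun u => exp (s * supportFunction T u)) hconv (by fun_prop)
    fun u => (exp_pos _).le
  have hm : Measurable fun u => ENNReal.ofReal (exp (s * supportFunction T u)) :=
    (show Continuous fun u => exp (s * supportFunction T u) by fun_prop).measurable.ennreal_ofReal
  rw [lintegral_map hm hW, lintegral_map hm (by fun_prop)] at h1
  have h2 : ∫⁻ u, ENNReal.ofReal (exp (s * supportFunction T (σ • u))) ∂(stdGaussian E) ≤
      ENNReal.ofReal (exp (3 * (v * w + v ^ 2 * 2 ^ 2))) := by
    have e : ∀ u, s * supportFunction T (σ • u) = v * supportFunction T u := fun u => by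
      rw [supportFunction_smul_eq hne hT hσ, hs]
      field_simp
    simp_rw [e]
    rw [← ofReal_integral_eq_lintegral_ofReal (integrable_exp_supportFunction hne hT hv0)
      (ae_of_all _ fun u => (exp_pos _).le)]
    exact ENNReal.ofReal_le_ofReal (integral_exp_supportFunction_le hT h0 hv0)
  set t := σ * (3 * w + 7 * β) with ht
  have h3 := mul_meas_ge_le_lintegral (μ := P) (hm.comp hW) (ENNReal.ofReal (exp (s * t)))
  have h4 : P {ω | t ≤ supportFunction T (W ω)} ≤
      P {ω | ENNReal.ofReal (exp (s * t)) ≤ ENNReal.ofReal (exp (s * supportFunction T (W ω)))} := by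
    refine measure_mono fun ω hω => ?_
    simp only [mem_ofPred_eq] at hω ⊢
    gcongr
  have h5 : ENNReal.ofReal (exp (s * t)) * P {ω | t ≤ supportFunction T (W ω)} ≤
      ENNReal.ofReal (exp (3 * (v * w + v ^ 2 * 2 ^ 2))) :=
    (mul_le_mul_right h4 _).trans (h3.trans (h1.trans h2))
  rw [mul_comm, ← ENNReal.le_div_iff_mul_le (by simp [exp_pos]) (by simp),
    ← ENNReal.ofReal_div_of_pos (exp_pos _), ← exp_sub] at h5
  refine h5.trans (ENNReal.ofReal_le_ofReal (exp_le_exp.2 ?_))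
  have e : s * t = v * (3 * w + 7 * β) := by rw [hs, ht]; field_simp
  rw [e, hv]
  nlinarith [sq_nonneg β]

end Deviation

/-! ### Assembly of the recovery bound. -/

section Main

open Filter Topology Set Real

lemma norm_le_two_of_mem_sub {E : Type*} [SeminormedAddCommGroup E] {K : Set E}
    (hK : K ⊆ Metric.closedBall 0 1) {z : E} (hz : z ∈ K - K) : ‖z‖ ≤ 2 := by
  obtain ⟨u, hu, v, hv, rfl⟩ := hz
  have h1 := mem_closedBall_zero_iff.1 (hK hu)
  have h2 := mem_closedBall_zero_iff.1 (hK hv)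
  exact (norm_sub_le u v).trans (by linarith)

/-- Expand the square and use `‖v‖² ≤ 1 = ‖x‖²`; it turns a linear gap in the objective into a
squared error. -/
lemma norm_sub_sq_le_two_mul_inner {E : Type*} [NormedAddCommGroup E] [InnerProductSpace ℝ E]
    {x v : E} (hx : ‖x‖ = 1) (hv : ‖v‖ ≤ 1) : ‖x - v‖ ^ 2 ≤ 2 * inner ℝ x (x - v) := by
  rw [norm_sub_sq_real, inner_sub_right, real_inner_self_eq_norm_sq, hx]
  nlinarith [norm_nonneg v]

lemma third_moment_constant_le {κ : ℝ} (hκ0 : 0 < κ) (hκ : 1 ≤ 2 * κ ^ 2) :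
    (κ * √3) ^ 3 + 1 ≤ 13 * κ ^ 4 := by
  have h3 : √3 < 1.8 := by rw [sqrt_lt' (by norm_num)]; norm_num
  have h4 : (κ * √3) ^ 3 = 3 * √3 * κ ^ 3 := by
    rw [mul_pow, show √3 ^ 3 = √3 ^ 2 * √3 by ring, sq_sqrt (by norm_num)]; ring
  have h5 : 2 / 3 ≤ κ := by nlinarith
  have h6 : 2 / 3 * κ ^ 3 ≤ κ ^ 4 := by
    have := mul_le_mul_of_nonneg_right h5 (pow_pos hκ0 3).le
    linarith [show κ * κ ^ 3 = κ ^ 4 by ring]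
  have h7 : 1 ≤ 4 * κ ^ 4 := by nlinarith
  have h8 : 3 * √3 * κ ^ 3 ≤ 5.4 * κ ^ 3 := by
    have := pow_pos hκ0 3
    nlinarith
  rw [h4]
  linarith

theorem theorem1p3 :
    ∃ C : ℝ, 0 < C ∧
      ∀ (m n : ℕ) (_ : 0 < m)
        -- the sub-gaussian variable `a`, symmetric and with unit variance
        (Ω₀ : Type*) [MeasurableSpace Ω₀] (P₀ : Measure Ω₀) [IsProbabilityMeasure P₀]
        (a : Ω₀ → ℝ)
        (_ : IdentDistrib a (-a) P₀ P₀) (_ : Var[a; P₀] = 1)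
        (_ : subGaussianNorm a P₀ < ∞)
        (κ : ℝ) (_ : κ = (subGaussianNorm a P₀).toReal)
        -- the measurement vectors: independent, with coordinates i.i.d. copies of `a`
        (Ω : Type*) [MeasurableSpace Ω] (P : Measure Ω) [IsProbabilityMeasure P]
        (A : Fin m → Ω → EuclideanSpace ℝ (Fin n))
        (_ : ∀ i, Measurable (A i)) (_ : iIndepFun A P)
        (_ : ∀ i, iIndepFun (fun j ω => A i ω j) P)
        (_ : ∀ i j, IdentDistrib (fun ω => A i ω j) a P P₀)
        -- the signal set and the signal
        (K : Set (EuclideanSpace ℝ (Fin n))) (_ : K ⊆ Metric.closedBall 0 1)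
        (x : EuclideanSpace ℝ (Fin n)) (_ : x ∈ K) (_ : ‖x‖ = 1)
        -- the function `θ`
        (θ : ℝ → ℝ) (_ : ∀ t, θ t ∈ Set.Icc (-1 : ℝ) 1) (_ : ContDiff ℝ 3 θ)
        (τ₂ τ₃ : ℝ) (_ : ∀ t, |iteratedDeriv 2 θ t| ≤ τ₂) (_ : ∀ t, |iteratedDeriv 3 θ t| ≤ τ₃)
        (lam : ℝ) (_ : lam = ∫ t, θ t * t ∂(gaussianReal 0 1)) (_ : 0 < lam)
        -- the one-bit measurements
        (y : Fin m → Ω → ℝ) (_ : GeneralizedLinearModel P A y x θ)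
        (β : ℝ) (_ : 0 < β),
        ∃ G : Set Ω, MeasurableSet G ∧ 1 - 4 * Real.exp (-β ^ 2) ≤ P.real G ∧
          ∀ ω ∈ G, ∀ xhat : EuclideanSpace ℝ (Fin n),
            IsSolution (fun i => A i ω) (fun i => y i ω) K xhat →
            ‖x - xhat‖ ^ 2 ≤
              C * (κ ^ 4 / lam * (τ₂ + τ₃) * coordSupNorm x
                + κ / (lam * √(m : ℝ)) * (gaussianMeanWidth K + β)) := by
  -- Twice 338 and twice 840 both lie below 2000; the doubling comes from `‖z‖² / 2`.
  refine ⟨2000, by norm_num, ?_⟩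
  intro m n hm Ω₀ _ P₀ _ a hsymm hvar hfin κ hκ Ω _ P _ A hAm hAind hAcoord hAid K hK x hxK hx θ hθ
    hθC τ₂ τ₃ hτ₂ hτ₃ lam hlam hlam0 y hy β hβ
  have hκ2 : 1 ≤ 2 * κ ^ 2 := hκ ▸ one_le_two_mul_sq_subGaussianNorm hsymm hvar hfin
  have hκ0 : 0 < κ := by
    refine lt_of_le_of_ne (hκ ▸ ENNReal.toReal_nonneg) fun h => ?_
    rw [← h] at hκ2
    norm_num at hκ2
  have hm0 : (0 : ℝ) < m := by exact_mod_cast hm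
  have hX : ∀ i, HasStandardCoords (A i) P ((κ * √3) ^ 3) := fun i => by
    rw [hκ]
    exact hasStandardCoords_of_identDistrib (hAm i) (hAcoord i) (hAid i) hsymm hvar hfin
  -- the increments are dominated by Gaussian vectors
  set γ := stdGaussian (EuclideanSpace ℝ (Fin n)) with hγ
  set L := 20 * (exp 1 * κ) with hL
  have hL0 : 0 < L := by positivity
  have hdom : ∀ i, ConvexDominated (P.map (A i)) (γ.map fun u => L • u) := fun i =>
    ConvexDominated.of_coords (hAm i) (hAcoord i) fun j => by
      rw [(hAid i j).map_eq]
      exact convexDominated_gaussianReal hsymm hfin hκ hκ0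
  set Z : Fin m → Ω → EuclideanSpace ℝ (Fin n) := fun i ω => y i ω • A i ω with hZ
  have hZm : ∀ i, Measurable (Z i) := fun i => (hy.measurable i).smul (hAm i)
  have hAi : ∀ i, Integrable (A i) P := fun i =>
    Integrable.of_eval_piLp fun j => ((hX i).memLp j).integrable (by norm_num)
  have hZA : ∀ i ω, Z i ω = A i ω ∨ Z i ω = -A i ω := fun i ω => by
    rcases hy.sign_valued i ω with h | h <;> simp [hZ, h]
  have hZi : ∀ i, Integrable (Z i) P := fun i =>
    (hAi i).mono (hZm i).aestronglyMeasurable (ae_of_all _ fun ω => by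
      rcases hZA i ω with h | h <;> simp [h])
  have hγsymm : ∀ c : ℝ, (γ.map fun u => c • u).map Neg.neg = γ.map fun u => c • u := fun c => by
    have h1 : γ.map Neg.neg = γ := stdGaussian_map (LinearIsometryEquiv.neg ℝ)
    rw [Measure.map_map (by fun_prop) (by fun_prop)]
    conv_rhs => rw [← h1, Measure.map_map (by fun_prop) (by fun_prop)]
    congr 1
    funext u
    simp
  set W : Fin m → Ω → EuclideanSpace ℝ (Fin n) := fun i ω => Z i ω - ∫ ω, Z i ω ∂P with hW
  have hWm : ∀ i, Measurable (W i) := fun i => (hZm i).sub_const _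
  have hWdom : ∀ i, ConvexDominated (P.map (W i)) (γ.map fun u => (2 * L) • u) := fun i => by
    refine ConvexDominated.symmetrization (hZm i) (hAm i) (hZi i) (hZA i) (hγsymm _) ?_
    have h1 := (hdom i).map ((2 : ℝ) • ContinuousLinearMap.id ℝ (EuclideanSpace ℝ (Fin n)))
    rw [Measure.map_map (by fun_prop) (hAm i), Measure.map_map (by fun_prop) (by fun_prop)] at h1
    convert h1 using 2 <;>
    · funext u
      simp [smul_smul]
  have hWind : iIndepFun W P :=
    (hy.iIndepFun_smul hAm hAind hθC.continuous.measurable).comp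
      (fun i u => u - ∫ ω, Z i ω ∂P) fun i => by fun_prop
  have hsum := ConvexDominated.sum_stdGaussian hWind hWm hWdom
  have hT : ∀ z ∈ K - K, ‖z‖ ≤ 2 := fun z hz => norm_le_two_of_mem_sub hK hz
  have h0T : (0 : EuclideanSpace ℝ (Fin n)) ∈ K - K := ⟨x, hxK, x, hxK, sub_self x⟩
  have hSm : Measurable (∑ i, W i) := by
    rw [Finset.sum_fn]
    exact Finset.measurable_sum _ fun i _ => hWm i
  set σ := √m * (2 * L) with hσ
  have hσ0 : 0 < σ := by positivity
  have htail := hsum.measure_supportFunction_ge_le hT h0T hSm hσ0 hβ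
  set S : Ω → ℝ := fun ω => supportFunction (K - K) ((∑ i, W i) ω) with hS
  have hSmeas : Measurable S :=
    (continuous_supportFunction ⟨0, h0T⟩ hT).measurable.comp hSm
  set w := gaussianMeanWidth K with hw
  have hww : ∫ u, supportFunction (K - K) u ∂γ = w := rfl
  rw [hww] at htail
  have hbad : MeasurableSet {ω | σ * (3 * w + 7 * β) ≤ S ω} :=
    measurableSet_le measurable_const hSmeas
  refine ⟨{ω | σ * (3 * w + 7 * β) ≤ S ω}ᶜ, hbad.compl, ?_, fun ω hω xhat hsol => ?_⟩
  · rw [probReal_compl_eq_one_sub hbad]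
    have h1 : P.real {ω | σ * (3 * w + 7 * β) ≤ S ω} ≤ exp (-β ^ 2) :=
      ENNReal.toReal_le_of_le_ofReal (exp_pos _).le htail
    have h2 := exp_pos (-β ^ 2)
    linarith
  -- the deterministic argument
  simp only [mem_compl_iff, mem_ofPred_eq, not_le] at hω
  obtain ⟨hxhat, hmax⟩ := hsol
  set z := x - xhat with hz
  have hobj : ∑ i, y i ω * inner ℝ (A i ω) z ≤ 0 := by
    have := hmax hxK
    simp only [mem_ofPred_eq] at this
    simp only [hz, inner_sub_right, mul_sub, Finset.sum_sub_distrib]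
    linarith
  have hτ0 : 0 ≤ τ₂ := (abs_nonneg _).trans (hτ₂ 0)
  have hτ0' : 0 ≤ τ₃ := (abs_nonneg _).trans (hτ₃ 0)
  set c := coordSupNorm x with hc
  have hc0 : 0 ≤ c := Real.iSup_nonneg fun j => abs_nonneg _
  have hz2 : ‖z‖ ≤ 2 := hT z ⟨x, hxK, xhat, hxhat, rfl⟩
  have hzx : ‖z‖ ^ 2 ≤ 2 * inner ℝ x z :=
    norm_sub_sq_le_two_mul_inner hx (mem_closedBall_zero_iff.1 (hK hxhat))
  have hθd : ∀ t, HasDerivAt θ (iteratedDeriv 1 θ t) t := fun t => by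
    rw [iteratedDeriv_one]
    exact (hθC.differentiable (by norm_num) t).hasDerivAt
  have hθd' : ∀ t, HasDerivAt (iteratedDeriv 1 θ) (iteratedDeriv 2 θ t) t := fun t => by
    rw [iteratedDeriv_succ (n := 1)]
    exact (hθC.differentiable_iteratedDeriv 1 (by norm_num) t).hasDerivAt
  -- Here `338 = 13 · 13 · 2`: the comparison constant, the moment bound `13 κ ^ 4`, and `‖z‖ ≤ 2`.
  have hmean : ∀ i, lam * (‖z‖ ^ 2 / 2) - 338 * (κ ^ 4 * τ₂ * c) ≤
      inner ℝ (∫ ω, Z i ω ∂P) z := fun i => by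
    have e1 : inner ℝ (∫ ω, Z i ω ∂P) z =
        ∫ ω, θ (inner ℝ (A i ω) x) * inner ℝ (A i ω) z ∂P := by
      rw [real_inner_comm, ← integral_inner (hZi i), ← hy.integral_mul_inner hAm i
        ((hX i).integrable_inner z)]
      refine integral_congr_ae (ae_of_all _ fun ω => ?_)
      change inner ℝ z (y i ω • A i ω) = _
      rw [real_inner_smul_right, real_inner_comm]
    have h1 := (hX i).abs_integral_sub_gaussian_le (fun t => abs_le.2 (hθ t)) hθd hθd' hτ₂ hx z
    rw [← e1, ← hlam] at h1
    have h2 : 13 * τ₂ * ((κ * √3) ^ 3 + 1) * c * ‖z‖ ≤ 13 * τ₂ * (13 * κ ^ 4) * c * 2 := by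
      gcongr
      exact third_moment_constant_le hκ0 hκ2
    have h3 := (abs_le.1 h1).1
    have h4 := mul_le_mul_of_nonneg_left hzx hlam0.le
    linarith
  have hdev : (m : ℝ) * (lam * (‖z‖ ^ 2 / 2) - 338 * (κ ^ 4 * τ₂ * c)) ≤
      σ * (3 * w + 7 * β) := by
    -- The deviation is tested in the direction `xhat - x`, where optimality makes the uncentred sum
    -- nonnegative.
    have h1 : inner ℝ ((∑ i, W i) ω) (-z) ≤ S ω :=
      inner_le_supportFunction hT _ ⟨xhat, hxhat, x, hxK, by simp [hz]⟩
    have h2 : inner ℝ ((∑ i, W i) ω) (-z) =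
        -(∑ i, y i ω * inner ℝ (A i ω) z) + ∑ i, inner ℝ (∫ ω, Z i ω ∂P) z := by
      simp only [Finset.sum_apply, sum_inner, inner_neg_right, hW, hZ, inner_sub_left,
        real_inner_smul_left, Finset.sum_sub_distrib]
      ring
    have h3 : ∑ _i : Fin m, (lam * (‖z‖ ^ 2 / 2) - 338 * (κ ^ 4 * τ₂ * c)) ≤
        ∑ i, inner ℝ (∫ ω, Z i ω ∂P) z := Finset.sum_le_sum fun i _ => hmean i
    rw [Finset.sum_const, Finset.card_univ, Fintype.card_fin, nsmul_eq_mul] at h3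
    linarith
  have hw0 : 0 ≤ w := by
    rw [← hww]
    exact integral_nonneg (supportFunction_nonneg hT h0T)
  have hsm : 0 < √(m : ℝ) := sqrt_pos.2 hm0
  have hdiv : lam * (‖z‖ ^ 2 / 2) - 338 * (κ ^ 4 * τ₂ * c) ≤
      120 * κ / √m * (7 * (w + β)) := by
    have h1 : σ * (3 * w + 7 * β) = m * (2 * L / √m * (3 * w + 7 * β)) := by
      rw [hσ]
      nth_rewrite 2 [← mul_self_sqrt hm0.le]
      field_simp
    rw [h1] at hdev
    refine (le_of_mul_le_mul_left hdev hm0).trans ?_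
    -- `2 L = 40 e κ` and `e < 3`.
    have h2 : 2 * L ≤ 120 * κ := by
      have := exp_one_lt_d9
      rw [hL]
      nlinarith
    gcongr
    linarith
  have hrhs : 2000 * (κ ^ 4 / lam * (τ₂ + τ₃) * c + κ / (lam * √m) * (w + β)) =
      2000 / lam * (κ ^ 4 * (τ₂ + τ₃) * c + κ / √m * (w + β)) := by
    field_simp
  rw [hrhs, div_mul_eq_mul_div, le_div_iff₀ hlam0]
  have hb : 0 ≤ κ / √m * (w + β) := by positivity
  have ha : κ ^ 4 * τ₂ * c ≤ κ ^ 4 * (τ₂ + τ₃) * c := by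
    gcongr
    linarith
  have ha0 : 0 ≤ κ ^ 4 * τ₂ * c := by positivity
  have h9 : 120 * κ / √m * (7 * (w + β)) = 840 * (κ / √m * (w + β)) := by ring
  linarith

end Main
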